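/- Let $G$ be a finite simple graph of order $n$. For real $p \ge 1$ the $p$-spectral radius of $G$ is $$\lambda^{(p)}(G) = \max\Big\{ 2\sum_{\{i,j\}\in E(G)} x_i x_j \;:\; x_1,\dots,x_n\in\mathbb{R},\ |x_1|^p+\cdots+|x_n|^p = 1 \Big\}.$$ An $r$-joint of size $t$ is a collection of $t$ distinct $r$-cliques (complete subgraphs on $r$ vertices) that share an edge, and $\mathrm{js}_r(G)$ denotes the maximum size of an $r$-joint in $G$ (with $\mathrm{js}_r(G)=0$ if there is none). $T_r(n)$ denotes the $r$-partite Turán graph of order $n$, that is, the complete $r$-partite graph of order $n$ with parts of size $\lfloor n/r\rfloor$ or $\lceil n/r\rceil$. Theorem. Let $r \ge 2$ be an integer and $p > 1$ a real number. If $G$ is a graph of order $n$ with $$\lambda^{(p)}(G) \ge \lambda^{(p)}(T_r(n)),$$ then $$\mathrm{js}_{r+1}(G) > \frac{n^{r-1}}{r^{\,r^6 p/(p-1)}},$$ unless $G = T_r(n)$ (up to isomorphism). -/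

import Mathlib

namespace PSpectral

/-- The quadratic form `2 ∑_{{i,j} ∈ E(G)} x_i x_j` of a finite graph `G`
(`Sym2.mul` sends the unordered pair `s(a, b)` to `a * b`). -/
noncomputable def quadForm {V : Type*} [Fintype V] (G : SimpleGraph V) (x : V → ℝ) : ℝ :=
  open Classical in 2 * ∑ e ∈ G.edgeFinset, (e.map x).mul

/-- The `p`-spectral radius of a finite graph: the largest value of the quadratic form
on the vectors `x` with `∑ |x_i|^p = 1`. -/
noncomputable def pSpectralRadius {V : Type*} [Fintype V] (p : ℝ) (G : SimpleGraph V) : ℝ :=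
  sSup {t : ℝ | ∃ x : V → ℝ, ∑ i, |x i| ^ p = 1 ∧ t = quadForm G x}

/-- The supremum in the definition of `pSpectralRadius` is a maximum, for all `p ≥ 1` and
every graph with at least one vertex. -/
theorem isGreatest_pSpectralRadius {V : Type*} [Fintype V] [Nonempty V] (p : ℝ) (hp : 1 ≤ p)
    (G : SimpleGraph V) :
    IsGreatest {t : ℝ | ∃ x : V → ℝ, ∑ i, |x i| ^ p = 1 ∧ t = quadForm G x}
      (pSpectralRadius p G) := by
  classical
  have hp0 : 0 < p := lt_of_lt_of_le one_pos hp
  have hset : {t : ℝ | ∃ x : V → ℝ, ∑ i, |x i| ^ p = 1 ∧ t = quadForm G x} =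
      quadForm G '' {x : V → ℝ | ∑ i, |x i| ^ p = 1} := by
    ext t
    simp only [Set.mem_ofPred_eq, Set.mem_image, eq_comm]
  have hcont : Continuous (quadForm G) := by
    unfold quadForm
    refine continuous_const.mul (continuous_finsetSum _ fun e _ => ?_)
    induction e using Sym2.ind with
    | _ a b => exact (continuous_apply a).mul (continuous_apply b)
  have hclosed : IsClosed {x : V → ℝ | ∑ i, |x i| ^ p = 1} := by
    refine isClosed_eq (continuous_finsetSum _ fun i _ => ?_) continuous_const
    exact (continuous_apply i).abs.rpow_const fun _ => Or.inr hp0.le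
  have hcompact : IsCompact {x : V → ℝ | ∑ i, |x i| ^ p = 1} := by
    refine (isCompact_closedBall (0 : V → ℝ) 1).of_isClosed_subset hclosed fun x hx => ?_
    rw [mem_closedBall_zero_iff, pi_norm_le_iff_of_nonneg zero_le_one]
    intro i
    have hle : |x i| ^ p ≤ 1 := by
      rw [← (show ∑ i, |x i| ^ p = 1 from hx)]
      exact Finset.single_le_sum (f := fun j => |x j| ^ p)
        (fun j _ => Real.rpow_nonneg (abs_nonneg _) _) (Finset.mem_univ i)
    rw [Real.norm_eq_abs]
    by_contra h
    exact absurd hle (not_le.mpr (Real.one_lt_rpow (not_le.mp h) hp0))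
  have hne : {x : V → ℝ | ∑ i, |x i| ^ p = 1}.Nonempty := by
    obtain ⟨v⟩ := ‹Nonempty V›
    refine ⟨Pi.single v 1, ?_⟩
    change ∑ i, |(Pi.single v 1 : V → ℝ) i| ^ p = 1
    rw [Finset.sum_eq_single v]
    · simp
    · intro j _ hj
      simp [hj, Real.zero_rpow hp0.ne']
    · simp
  unfold pSpectralRadius
  rw [hset]
  exact (hcompact.image hcont).isGreatest_sSup (hne.image _)

/-- An `r`-joint of `G`: a collection of distinct `r`-cliques of `G` that share an edge of `G`.
Its size is its cardinality. -/
def IsJoint {V : Type*} (G : SimpleGraph V) (r : ℕ) (C : Finset (Finset V)) : Prop :=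
  ∃ u v : V, G.Adj u v ∧ ∀ K ∈ C, G.IsNClique r K ∧ u ∈ K ∧ v ∈ K

/-- `js_r(G)`, the maximum size of an `r`-joint in a finite graph `G` (`0` if there is none). -/
noncomputable def jointSize {V : Type*} [Fintype V] (G : SimpleGraph V) (r : ℕ) : ℕ :=
  sSup {t : ℕ | ∃ C : Finset (Finset V), IsJoint G r C ∧ C.card = t}

end PSpectral

/-! Write q = 1 - 1/p, so the exponent in the bound is r^6/q, and call λ^(p)(H)/|H|^(2q) the density
of H. It is at most 1, at most 1 - 1/r when H has no (r+1)-clique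
(`pSpectralRadius_le_of_cliqueFree`), and at least 1 - 1/r - r/n² for the Turán graph
(`le_pSpectralRadius_turanGraph`).

The spectral Turán theorem (`nonempty_iso_turanGraph_of_le`) comes from Zykov symmetrization applied
to an optimal graph together with an optimal vector. It shows that G, not being the Turán graph,
contains an (r+1)-clique. If n is so small that the claimed bound is below 1, this single clique
suffices.

For large n the aim is a subgraph of large minimum degree. With η = 1/(4r^4), choose S maximizing
λ^(p)(G[S])/|S|^(2q(1-η)) (`exists_critical_induce`). Deleting a vertex of G[S] then costs almost
the full factor (1 - 1/|S|)^(2q). This forces the entries of an optimal vector to be nearly equal,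
and the eigenvalue equations give minimum degree nearly (1 - 1/r)|S|
(`le_degree_of_forall_deletion`). Since densities never exceed 1, S has at least n·r^(-5r^4/(2q))
vertices. An (r+1)-clique survives in G[S]: either S is everything, or the density has risen above 1
- 1/r (`density_lt_of_card_lt`).

Finally, in a graph of such minimum degree some edge of an (r+1)-clique has many common neighbours,
and greedy extension inside this common neighbourhood yields many (r+1)-cliques on that edge
(`le_jointSize_of_minDegree`). -/

namespace PSpectral

open Finset

/-! ### The quadratic form, its maximizers and the eigenvalue equations. -/

section Basics

variable {V : Type*} [Fintype V]

/-- The sum of the entries of `x` over the neighbours of `u`. -/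
noncomputable def nbrSum (G : SimpleGraph V) (x : V → ℝ) (u : V) : ℝ :=
  open Classical in ∑ v, if G.Adj u v then x v else 0

theorem quadForm_eq_sum_nbrSum (G : SimpleGraph V) (x : V → ℝ) :
    quadForm G x = ∑ u, x u * nbrSum G x u := by
  classical
  have h1 : ∑ u, x u * nbrSum G x u = ∑ d : G.Dart, x d.fst * x d.snd := by
    have : ∀ u, x u * nbrSum G x u =
        ∑ d : G.Dart with d.fst = u, x d.fst * x d.snd := by
      intro u
      rw [nbrSum, ← sum_filter, mul_sum]
      symm
      refine sum_bij' (fun d _ => d.snd) (fun v hv => ⟨(u, v), by simpa using hv⟩) ?_ ?_ ?_ ?_ ?_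
      · rintro ⟨⟨a, b⟩, h⟩ hd
        simp only [mem_filter, mem_univ, true_and] at hd ⊢
        subst hd; exact h
      · intro v hv; simp
      · rintro ⟨⟨a, b⟩, h⟩ hd
        simp only [mem_filter, mem_univ, true_and] at hd
        subst hd; rfl
      · intro v hv; rfl
      · rintro ⟨⟨a, b⟩, h⟩ hd
        simp only [mem_filter, mem_univ, true_and] at hd
        subst hd; rfl
    simp_rw [this]
    exact sum_fiberwise univ (fun d : G.Dart => d.fst) (fun d => x d.fst * x d.snd)
  have h2 : ∑ d : G.Dart, x d.fst * x d.snd = ∑ d : G.Dart, (d.edge.map x).mul :=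
    sum_congr rfl fun d _ => rfl
  have h3 : ∑ d : G.Dart, (d.edge.map x).mul =
      ∑ e ∈ G.edgeFinset, ∑ d : G.Dart with d.edge = e, (d.edge.map x).mul := by
    refine (sum_fiberwise_of_maps_to (fun d _ => ?_) _).symm
    simp
  rw [h1, h2, h3, quadForm, mul_sum]
  refine sum_congr (by congr) fun e he => ?_
  rw [sum_congr rfl (g := fun _ => (e.map x).mul) (by simp +contextual), sum_const,
    G.dart_edge_fiber_card e (by simpa using he)]
  simp

theorem quadForm_eq_sum (G : SimpleGraph V) [DecidableRel G.Adj] (x : V → ℝ) :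
    quadForm G x = ∑ u, ∑ v, if G.Adj u v then x u * x v else 0 := by
  rw [quadForm_eq_sum_nbrSum]
  refine sum_congr rfl fun u _ => ?_
  rw [nbrSum, mul_sum]
  refine sum_congr rfl fun v _ => ?_
  split_ifs <;> simp

theorem quadForm_iso {W : Type*} [Fintype W] {G : SimpleGraph V} {H : SimpleGraph W}
    (f : G ≃g H) (x : W → ℝ) : quadForm G (x ∘ f) = quadForm H x := by
  classical
  rw [quadForm_eq_sum, quadForm_eq_sum, ← f.toEquiv.sum_comp]
  refine sum_congr rfl fun u _ => ?_
  rw [← f.toEquiv.sum_comp]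
  refine sum_congr rfl fun v _ => ?_
  simp [SimpleGraph.Iso.map_adj_iff]

theorem pSpectralRadius_iso {W : Type*} [Fintype W] {G : SimpleGraph V} {H : SimpleGraph W}
    (f : G ≃g H) (p : ℝ) : pSpectralRadius p G = pSpectralRadius p H := by
  unfold pSpectralRadius
  congr 1
  ext t
  constructor
  · rintro ⟨x, hx, rfl⟩
    refine ⟨x ∘ f.symm, ?_, (quadForm_iso f.symm x).symm⟩
    rw [← hx]
    exact f.symm.toEquiv.sum_comp fun i => |x i| ^ p
  · rintro ⟨x, hx, rfl⟩
    refine ⟨x ∘ f, ?_, (quadForm_iso f x).symm⟩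
    rw [← hx]
    exact f.toEquiv.sum_comp fun i => |x i| ^ p

theorem quadForm_smul (G : SimpleGraph V) (c : ℝ) (x : V → ℝ) :
    quadForm G (fun v => c * x v) = c ^ 2 * quadForm G x := by
  classical
  rw [quadForm_eq_sum, quadForm_eq_sum, mul_sum]
  refine sum_congr rfl fun u _ => ?_
  rw [mul_sum]
  refine sum_congr rfl fun v _ => ?_
  split_ifs <;> ring

theorem quadForm_zero (G : SimpleGraph V) : quadForm G 0 = 0 := by
  classical
  simp [quadForm_eq_sum]

theorem quadForm_mono {G : SimpleGraph V} {x y : V → ℝ} (hx : ∀ v, |x v| ≤ y v) :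
    quadForm G x ≤ quadForm G y := by
  classical
  rw [quadForm_eq_sum, quadForm_eq_sum]
  refine sum_le_sum fun u _ => sum_le_sum fun v _ => ?_
  split_ifs
  · refine (le_abs_self _).trans ?_
    rw [abs_mul]
    exact mul_le_mul (hx u) (hx v) (abs_nonneg _) ((abs_nonneg _).trans (hx u))
  · exact le_rfl

theorem quadForm_nonneg {G : SimpleGraph V} {x : V → ℝ} (hx : ∀ v, 0 ≤ x v) :
    0 ≤ quadForm G x := by
  simpa [quadForm_zero] using quadForm_mono (G := G) (x := 0) (y := x) (by simpa using hx)

/-- There are no loops, so the form is affine in each single coordinate, with slope twice `nbrSum`.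
-/
theorem quadForm_update [DecidableEq V] (G : SimpleGraph V) (x : V → ℝ) (u : V) (a : ℝ) :
    quadForm G (Function.update x u a) = quadForm G x + 2 * (a - x u) * nbrSum G x u := by
  classical
  have e1 : ∀ w, nbrSum G (Function.update x u a) w =
      nbrSum G x w + if G.Adj w u then a - x u else 0 := by
    intro w
    have : ∀ v, (if G.Adj w v then Function.update x u a v else 0) =
        (if G.Adj w v then x v else 0) + if v = u then (if G.Adj w u then a - x u else 0) else 0 := by
      intro v
      by_cases hv : v = u
      · subst hv; simp; split_ifs <;> simp
      · simp [hv]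
    unfold nbrSum
    simp_rw [this, sum_add_distrib]
    simp
  have e2 : ∑ w, x w * (if G.Adj w u then a - x u else 0) = (a - x u) * nbrSum G x u := by
    rw [nbrSum, mul_sum]
    refine sum_congr rfl fun w _ => ?_
    rw [G.adj_comm w u]
    split_ifs <;> ring
  have e3 : ∀ w, Function.update x u a w * nbrSum G (Function.update x u a) w =
      x w * nbrSum G x w + x w * (if G.Adj w u then a - x u else 0)
        + if w = u then (a - x u) * nbrSum G x u else 0 := by
    intro w
    rw [e1]
    by_cases hw : w = u
    · subst hw; simp; ring
    · simp only [Function.update_of_ne hw, if_neg hw]; ring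
  rw [quadForm_eq_sum_nbrSum, quadForm_eq_sum_nbrSum]
  simp_rw [e3, sum_add_distrib, e2]
  simp
  ring

theorem quadForm_le_sq_sum (G : SimpleGraph V) {x : V → ℝ} (hx : ∀ v, 0 ≤ x v) :
    quadForm G x ≤ (∑ v, x v) ^ 2 := by
  classical
  rw [quadForm_eq_sum, sq, sum_mul_sum]
  refine sum_le_sum fun u _ => sum_le_sum fun v _ => ?_
  split_ifs
  · exact le_rfl
  · exact mul_nonneg (hx u) (hx v)

/-- If `M` bounds the form relative to the `p`-norm and `x ≥ 0` attains the bound, then `x`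
satisfies the eigenvalue equations. -/
theorem nbrSum_eq_of_forall_le {p : ℝ} (hp : 1 < p) {G : SimpleGraph V} {x : V → ℝ} {M : ℝ}
    (hx : ∀ v, 0 ≤ x v) (hsum : ∑ v, x v ^ p = 1) (hM : quadForm G x = M)
    (hle : ∀ y : V → ℝ, quadForm G y ≤ M * (∑ v, |y v| ^ p) ^ (2 / p)) (u : V) :
    nbrSum G x u = M * x u ^ (p - 1) := by
  classical
  have hp0 : 0 < p := by linarith
  have hs : ∀ a : ℝ, ∑ v, |Function.update x u a v| ^ p = 1 - x u ^ p + |a| ^ p := by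
    intro a
    rw [← hsum, ← add_sum_erase _ _ (mem_univ u), ← add_sum_erase _ (fun v => x v ^ p) (mem_univ u)]
    have : ∑ v ∈ univ.erase u, |Function.update x u a v| ^ p = ∑ v ∈ univ.erase u, x v ^ p := by
      refine sum_congr rfl fun v hv => ?_
      rw [Function.update_of_ne (ne_of_mem_erase hv), abs_of_nonneg (hx v)]
    rw [this]
    simp
    ring
  -- `F` measures the slack in `hle` when only the coordinate at `u` varies. It is nonnegative and
  -- vanishes at `x u`. As p > 1, it is differentiable there even if `x u = 0`, so no positivity is
  -- needed.
  let F : ℝ → ℝ := fun a => M * (1 - x u ^ p + |a| ^ p) ^ (2 / p) -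
    (M + 2 * (a - x u) * nbrSum G x u)
  have hF0 : F (x u) = 0 := by
    simp [F, abs_of_nonneg (hx u)]
  have hFnn : ∀ a, 0 ≤ F a := by
    intro a
    have := hle (Function.update x u a)
    rw [hs, quadForm_update, hM] at this
    simpa [F] using this
  have hmin : IsLocalMin F (x u) := Filter.Eventually.of_forall fun a => by
    rw [hF0]; exact hFnn a
  have hd1 := (hasDerivAt_abs_rpow (x u) hp).const_add (1 - x u ^ p)
  have hbase : 1 - x u ^ p + |x u| ^ p = 1 := by rw [abs_of_nonneg (hx u)]; ring
  have hd2 := (hd1.rpow_const (p := 2 / p) (Or.inl (by rw [hbase]; norm_num))).const_mul M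
  have hd3 := ((((hasDerivAt_id (x u)).sub_const (x u)).const_mul 2).mul_const
    (nbrSum G x u)).const_add M
  have hd := hmin.hasDerivAt_eq_zero (hd2.sub hd3)
  rw [hbase, Real.one_rpow] at hd
  have hpow : |x u| ^ (p - 2) * x u = x u ^ (p - 1) := by
    rw [abs_of_nonneg (hx u)]
    rcases (hx u).eq_or_lt with h | h
    · rw [← h, mul_zero, Real.zero_rpow (by linarith)]
    · nth_rewrite 2 [← Real.rpow_one (x u)]
      rw [← Real.rpow_add h]; ring_nf
  rw [mul_assoc p, hpow] at hd
  field_simp at hd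
  simp at hd
  linarith

variable [Nonempty V] {p : ℝ}

theorem quadForm_le_pSpectralRadius (hp : 1 ≤ p) (G : SimpleGraph V) (x : V → ℝ) :
    quadForm G x ≤ pSpectralRadius p G * (∑ v, |x v| ^ p) ^ (2 / p) := by
  have hp0 : 0 < p := by linarith
  set N := ∑ v, |x v| ^ p with hN
  have hN0 : 0 ≤ N := sum_nonneg fun v _ => Real.rpow_nonneg (abs_nonneg _) _
  rcases hN0.eq_or_lt with h | h
  · have hx : x = 0 := by
      funext v
      have := (sum_eq_zero_iff_of_nonneg fun v _ => Real.rpow_nonneg (abs_nonneg (x v)) p).1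
        (hN ▸ h.symm) v (mem_univ v)
      simpa using (Real.rpow_eq_zero (abs_nonneg (x v)) hp0.ne').1 this
    rw [← h, hx, quadForm_zero, Real.zero_rpow (by positivity), mul_zero]
  · have key := (isGreatest_pSpectralRadius p hp G).2
      (show quadForm G (fun v => N ^ (-(1 / p)) * x v) ∈ _ from ⟨_, ?_, rfl⟩)
    · rw [quadForm_smul] at key
      have h2 : (N ^ (-(1 / p))) ^ 2 = (N ^ (2 / p))⁻¹ := by
        rw [← Real.rpow_natCast, ← Real.rpow_mul h.le, ← Real.rpow_neg h.le]
        congr 1; push_cast; ring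
      rw [h2, inv_mul_le_iff₀ (by positivity)] at key
      linarith
    · have : ∀ v, |N ^ (-(1 / p)) * x v| ^ p = N⁻¹ * |x v| ^ p := by
        intro v
        rw [abs_mul, abs_of_nonneg (by positivity), Real.mul_rpow (by positivity) (abs_nonneg _),
          ← Real.rpow_mul h.le, ← Real.rpow_neg_one N]
        congr 2; field_simp
      simp_rw [this, ← mul_sum]
      exact inv_mul_cancel₀ h.ne'

theorem exists_nonneg_maximizer (hp : 1 ≤ p) (G : SimpleGraph V) :
    ∃ x : V → ℝ, (∀ v, 0 ≤ x v) ∧ ∑ v, x v ^ p = 1 ∧ quadForm G x = pSpectralRadius p G := by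
  obtain ⟨x, hx, he⟩ := (isGreatest_pSpectralRadius p hp G).1
  refine ⟨fun v => |x v|, fun v => abs_nonneg _, hx, le_antisymm ?_ ?_⟩
  · exact (isGreatest_pSpectralRadius p hp G).2 ⟨fun v => |x v|, by simpa using hx, rfl⟩
  · rw [he]; exact quadForm_mono fun v => le_rfl

theorem sum_rpow_le_card {x : V → ℝ} (hp : 1 < p) (hx : ∀ v, 0 ≤ x v) (hsum : ∑ v, x v ^ p ≤ 1) :
    ∑ v, x v ≤ (Fintype.card V : ℝ) ^ (1 - 1 / p) := by
  have hp0 : 0 < p := by linarith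
  have h := Real.inner_le_Lp_mul_Lq_of_nonneg univ (f := x) (g := fun _ => (1 : ℝ))
    (Real.HolderConjugate.conjExponent hp) (fun v _ => hx v) (fun _ _ => zero_le_one)
  simp only [mul_one, Real.one_rpow, sum_const, nsmul_eq_mul, card_univ] at h
  refine h.trans ?_
  have hq : 1 / p.conjExponent = 1 - 1 / p := by
    unfold Real.conjExponent; field_simp
  rw [hq]
  refine mul_le_of_le_one_left (by positivity) ?_
  exact Real.rpow_le_one (sum_nonneg fun v _ => Real.rpow_nonneg (hx v) _) hsum (by positivity)

theorem pSpectralRadius_le_card_rpow (hp : 1 < p) (G : SimpleGraph V) :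
    pSpectralRadius p G ≤ (Fintype.card V : ℝ) ^ (2 * (1 - 1 / p)) := by
  obtain ⟨x, hx, hs, h⟩ := exists_nonneg_maximizer hp.le G
  rw [← h, mul_comm, Real.rpow_mul (by positivity), Real.rpow_two]
  exact (quadForm_le_sq_sum G hx).trans
    (pow_le_pow_left₀ (sum_nonneg fun v _ => hx v) (sum_rpow_le_card hp hx hs.le) 2)

end Basics

/-! ### Zykov symmetrization: extremal graphs are complete multipartite. -/

section Extremal

variable {V : Type*} [Fintype V]

/-- `G` has the largest `p`-spectral radius among the graphs on `V` with no clique on `r + 1`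
vertices, and `x` is a nonnegative vector that attains it. -/
structure IsExtremalPair (p : ℝ) (r : ℕ) (G : SimpleGraph V) (x : V → ℝ) : Prop where
  cliqueFree : G.CliqueFree (r + 1)
  nonneg : ∀ v, 0 ≤ x v
  sum_eq : ∑ v, x v ^ p = 1
  le : ∀ H : SimpleGraph V, H.CliqueFree (r + 1) → ∀ y : V → ℝ,
    quadForm H y ≤ quadForm G x * (∑ v, |y v| ^ p) ^ (2 / p)

namespace IsExtremalPair

variable {p : ℝ} {r : ℕ} {G : SimpleGraph V} {x : V → ℝ}

theorem le_self (h : IsExtremalPair p r G x) {H : SimpleGraph V} (hH : H.CliqueFree (r + 1)) :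
    quadForm H x ≤ quadForm G x := by
  have := h.le H hH x
  simpa [abs_of_nonneg (h.nonneg _), h.sum_eq] using this

/-- After a symmetrization that preserves the form, the same vector satisfies the eigenvalue
equations of the new graph as well; the arguments below compare the two systems. -/
theorem of_eq (h : IsExtremalPair p r G x) {H : SimpleGraph V} (hH : H.CliqueFree (r + 1))
    (he : quadForm H x = quadForm G x) : IsExtremalPair p r H x :=
  ⟨hH, h.nonneg, h.sum_eq, by rw [he]; exact h.le⟩

theorem nbrSum_eq (h : IsExtremalPair p r G x) (hp : 1 < p) (u : V) :
    nbrSum G x u = quadForm G x * x u ^ (p - 1) :=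
  nbrSum_eq_of_forall_le hp h.nonneg h.sum_eq rfl (h.le G h.cliqueFree) u

end IsExtremalPair

theorem exists_isExtremalPair [Nonempty V] {p : ℝ} {r : ℕ} (hp : 1 ≤ p) (hr : 0 < r) :
    ∃ (G : SimpleGraph V) (x : V → ℝ), IsExtremalPair p r G x := by
  obtain ⟨G, hG, hmax⟩ := Set.exists_max_image {G : SimpleGraph V | G.CliqueFree (r + 1)}
    (pSpectralRadius p) (Set.toFinite _) ⟨⊥, SimpleGraph.cliqueFree_bot (by lia)⟩
  obtain ⟨x, hx, hs, he⟩ := exists_nonneg_maximizer hp G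
  refine ⟨G, x, hG, hx, hs, fun H hH y => (quadForm_le_pSpectralRadius hp H y).trans ?_⟩
  rw [he]
  exact mul_le_mul_of_nonneg_right (hmax H hH)
    (Real.rpow_nonneg (sum_nonneg fun v _ => Real.rpow_nonneg (abs_nonneg _) _) _)

theorem quadForm_congr_of_zero {G H : SimpleGraph V} {t : V} {x : V → ℝ} (hx : x t = 0)
    (h : ∀ v w, v ≠ t → w ≠ t → (G.Adj v w ↔ H.Adj v w)) : quadForm G x = quadForm H x := by
  classical
  rw [quadForm_eq_sum, quadForm_eq_sum]
  refine sum_congr rfl fun v _ => sum_congr rfl fun w _ => ?_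
  by_cases hv : v = t
  · simp [hv, hx]
  by_cases hw : w = t
  · simp [hw, hx]
  simp [h v w hv hw]

/-- Once the coordinate at `t` is set to zero the two graphs have the same form, so they differ only
by the terms linear in `x t`. -/
theorem quadForm_replaceVertex [DecidableEq V] (G : SimpleGraph V) (s t : V) (x : V → ℝ) :
    quadForm (G.replaceVertex s t) x =
      quadForm G x + 2 * x t * (nbrSum (G.replaceVertex s t) x t - nbrSum G x t) := by
  have h1 := quadForm_update G x t 0
  have h2 := quadForm_update (G.replaceVertex s t) x t 0
  have h3 := quadForm_congr_of_zero (G := G) (H := G.replaceVertex s t) (t := t)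
    (x := Function.update x t 0) (by simp)
    fun v w hv hw => (G.adj_replaceVertex_iff_of_ne s hv hw).symm
  linarith

/-- The copy is not joined to `s`, so an edge between `s` and `t` would be lost; this is harmless
only if `x t = 0`. -/
theorem nbrSum_replaceVertex [DecidableEq V] {G : SimpleGraph V} {s t : V} {x : V → ℝ}
    (h : ¬ G.Adj s t ∨ x t = 0) : nbrSum (G.replaceVertex s t) x t = nbrSum G x s := by
  classical
  unfold nbrSum
  refine sum_congr rfl fun w _ => ?_
  by_cases hw : w = t
  · subst hw
    rcases h with h | h <;> simp [h]
  · simp only [G.adj_replaceVertex_iff_of_ne_right s hw]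

namespace IsExtremalPair

variable {p : ℝ} {r : ℕ} {G : SimpleGraph V} {x : V → ℝ}

theorem quadForm_pos (h : IsExtremalPair p r G x) (hr : 2 ≤ r) (hV : 2 ≤ Fintype.card V) :
    0 < quadForm G x := by
  classical
  obtain ⟨a, b, hab⟩ := Fintype.exists_pair_of_one_lt_card hV
  have h1 := h.le ((⊥ : SimpleGraph V) ⊔ SimpleGraph.edge a b)
    (((SimpleGraph.cliqueFree_bot (le_refl 2)).sup_edge a b).mono (by lia)) (fun _ => 1)
  have h2 : 0 < quadForm ((⊥ : SimpleGraph V) ⊔ SimpleGraph.edge a b) (fun _ => (1 : ℝ)) := by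
    rw [quadForm_eq_sum]
    refine sum_pos' (fun u _ => sum_nonneg fun v _ => by positivity) ⟨a, mem_univ a, ?_⟩
    refine sum_pos' (fun v _ => by positivity) ⟨b, mem_univ b, ?_⟩
    simp [SimpleGraph.edge_adj, hab]
  exact pos_of_mul_pos_left (h2.trans_le h1) (by positivity)

/-- If `x u = 0`, turning `u` into a copy of a vertex `s` of positive weight does not change the
form. The eigenvalue equation at `u` in the new graph then says that the neighbour sum of `s` is
zero, which contradicts the equation at `s`. -/
theorem pos (h : IsExtremalPair p r G x) (hp : 1 < p) (hr : 2 ≤ r) (hV : 2 ≤ Fintype.card V)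
    (u : V) : 0 < x u := by
  classical
  have hM := h.quadForm_pos hr hV
  refine (h.nonneg u).lt_of_ne' fun hu => ?_
  obtain ⟨s, hs⟩ : ∃ s, 0 < x s := by
    by_contra! hc
    have : ∀ v, x v = 0 := fun v => le_antisymm (hc v) (h.nonneg v)
    have h1 := h.sum_eq
    simp [this, Real.zero_rpow (by linarith : p ≠ 0)] at h1
  have hq : quadForm (G.replaceVertex s u) x = quadForm G x := by
    rw [quadForm_replaceVertex, hu]; ring
  have h1 := (h.of_eq (h.cliqueFree.replaceVertex s u) hq).nbrSum_eq hp u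
  rw [nbrSum_replaceVertex (Or.inr hu), h.nbrSum_eq hp, hu, Real.zero_rpow (by linarith),
    mul_zero] at h1
  exact (mul_pos hM (Real.rpow_pos_of_pos hs _)).ne' h1

/-- Otherwise replacing the vertex with the smaller neighbour sum by a copy of the other would
increase the form. -/
theorem nbrSum_eq_of_not_adj (h : IsExtremalPair p r G x) (hx : ∀ v, 0 < x v) {s t : V}
    (hst : ¬ G.Adj s t) : nbrSum G x s = nbrSum G x t := by
  classical
  have key : ∀ a b, ¬ G.Adj a b → nbrSum G x a ≤ nbrSum G x b := by
    intro a b hab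
    have h1 := h.le_self (h.cliqueFree.replaceVertex a b)
    rw [quadForm_replaceVertex, nbrSum_replaceVertex (Or.inl hab)] at h1
    by_contra! hc
    have := mul_pos (mul_pos two_pos (hx b)) (sub_pos.2 hc)
    linarith
  exact le_antisymm (key s t hst) (key t s fun h => hst h.symm)

/-- If `u` and `w` were adjacent, make `u` a copy of `v`. The form is unchanged, so the nonadjacent
`v` and `w` have equal neighbour sums both before and after; but `w` loses `x u > 0` and `v` loses
nothing. -/
theorem not_adj_trans (h : IsExtremalPair p r G x) (hx : ∀ v, 0 < x v) {u v w : V}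
    (huv : ¬ G.Adj u v) (hvw : ¬ G.Adj v w) : ¬ G.Adj u w := by
  classical
  intro huw
  have hvu : ¬ G.Adj v u := fun h => huv h.symm
  have nvu : v ≠ u := fun a => hvw (a ▸ huw)
  have h1 : IsExtremalPair p r (G.replaceVertex v u) x := by
    refine h.of_eq (h.cliqueFree.replaceVertex v u) ?_
    rw [quadForm_replaceVertex, nbrSum_replaceVertex (Or.inl hvu), h.nbrSum_eq_of_not_adj hx hvu]
    ring
  have h2 := h1.nbrSum_eq_of_not_adj hx
    ((G.adj_replaceVertex_iff_of_ne v nvu huw.ne').not.mpr hvw)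
  have h3 : nbrSum (G.replaceVertex v u) x v = nbrSum G x v := by
    unfold nbrSum
    refine sum_congr rfl fun a _ => ?_
    by_cases ha : a = u
    · subst ha; simp [hvu, G.not_adj_replaceVertex_same]
    · simp only [G.adj_replaceVertex_iff_of_ne v nvu ha]
  have h4 : nbrSum (G.replaceVertex v u) x w = nbrSum G x w - x u := by
    unfold nbrSum
    rw [← add_sum_erase _ _ (mem_univ u), ← add_sum_erase _ _ (mem_univ u)]
    have e1 : ¬ (G.replaceVertex v u).Adj w u := by
      rw [SimpleGraph.adj_comm, G.adj_replaceVertex_iff_of_ne_right v huw.ne']; exact hvw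
    rw [if_neg e1, if_pos huw.symm]
    rw [sum_congr rfl (g := fun a => if G.Adj w a then x a else 0)]
    · ring
    · intro a ha
      simp only [G.adj_replaceVertex_iff_of_ne v huw.ne' (ne_of_mem_erase ha)]
  have h5 := h.nbrSum_eq_of_not_adj hx hvw
  have := hx u
  linarith

/-- An extremal graph is complete multipartite with at most `r` parts. -/
theorem exists_coloring (h : IsExtremalPair p r G x) (hx : ∀ v, 0 < x v) :
    ∃ c : V → Fin r, ∀ u v, G.Adj u v ↔ c u ≠ c v := by
  classical
  let S : Setoid V := ⟨(¬ G.Adj · ·), by simp, fun h a => h a.symm, fun a b => h.not_adj_trans hx a b⟩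
  have hcard : Fintype.card (Quotient S) ≤ r := by
    by_contra! hlt
    refine h.cliqueFree.mono (Nat.succ_le_of_lt hlt) (univ.image (Quotient.out : Quotient S → V)) ⟨?_, ?_⟩
    · intro a ha b hb hab
      simp only [coe_image, coe_univ, Set.image_univ, Set.mem_range] at ha hb
      obtain ⟨a, rfl⟩ := ha
      obtain ⟨b, rfl⟩ := hb
      by_contra hc
      exact hab (congrArg _ (by simpa using Quotient.sound (s := S) hc))
    · rw [card_image_of_injective _ Quotient.out_injective, card_univ]
  obtain ⟨e⟩ := Function.Embedding.nonempty_of_card_le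
    (show Fintype.card (Quotient S) ≤ Fintype.card (Fin r) by simpa using hcard)
  refine ⟨fun v => e (Quotient.mk S v), fun u v => ?_⟩
  rw [Ne, e.injective.eq_iff, Quotient.eq]
  change _ ↔ ¬ ¬ _
  simp

end IsExtremalPair

theorem cliqueFree_of_coloring {W : Type*} {r : ℕ} {G : SimpleGraph W} {c : W → Fin r}
    (hc : ∀ u v, G.Adj u v → c u ≠ c v) : G.CliqueFree (r + 1) :=
  (show G.Colorable r from ⟨SimpleGraph.Coloring.mk c fun {u v} => hc u v⟩).cliqueFree (by lia)

theorem sum_comp_coloring {ι : Type*} [Fintype ι] [DecidableEq ι] (c : V → ι) (g : ι → ℝ) :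
    ∑ v, g (c v) = ∑ i, (#{v | c v = i} : ℝ) * g i := by
  rw [← sum_fiberwise univ c]
  refine sum_congr rfl fun i _ => ?_
  rw [sum_congr rfl (g := fun _ => g i) (by simp +contextual)]
  simp

theorem quadForm_coloring {ι : Type*} [Fintype ι] [DecidableEq ι] {G : SimpleGraph V} {c : V → ι}
    (hc : ∀ u v, G.Adj u v ↔ c u ≠ c v) (x : V → ℝ) :
    quadForm G x = (∑ v, x v) ^ 2 - ∑ i, (∑ v with c v = i, x v) ^ 2 := by
  classical
  have h1 : ∑ i, (∑ v with c v = i, x v) ^ 2 = ∑ u, ∑ v, if c v = c u then x u * x v else 0 := by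
    rw [← sum_fiberwise univ c]
    refine sum_congr rfl fun i _ => ?_
    rw [sq, sum_mul_sum]
    refine sum_congr rfl fun u hu => ?_
    rw [(mem_filter.1 hu).2, sum_filter]
  rw [h1, quadForm_eq_sum, sq, sum_mul_sum, ← sum_sub_distrib]
  refine sum_congr rfl fun u _ => ?_
  rw [← sum_sub_distrib]
  refine sum_congr rfl fun v _ => ?_
  by_cases h : c u = c v
  · simp [hc, h]
  · simp [hc, h, Ne.symm h]

/-- Cauchy–Schwarz applied to the weights of the `r` classes. -/
theorem quadForm_coloring_le {r : ℕ} (hr : 0 < r) {G : SimpleGraph V} {c : V → Fin r}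
    (hc : ∀ u v, G.Adj u v ↔ c u ≠ c v) (x : V → ℝ) :
    quadForm G x ≤ (1 - 1 / r) * (∑ v, x v) ^ 2 := by
  have hr' : (0 : ℝ) < r := by exact_mod_cast hr
  have h := sq_sum_le_card_mul_sum_sq (s := (univ : Finset (Fin r)))
    (f := fun i => ∑ v with c v = i, x v)
  rw [sum_fiberwise univ c] at h
  rw [quadForm_coloring hc]
  simp only [card_univ, Fintype.card_fin] at h
  have : (∑ v, x v) ^ 2 / r ≤ ∑ i, (∑ v with c v = i, x v) ^ 2 := by
    rw [div_le_iff₀ hr']; linarith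
  rw [sub_mul, one_mul, div_mul_eq_mul_div, one_mul]
  linarith

/-- The spectral form of Turán's bound: a graph with no clique on `r + 1` vertices has
`λ^(p) ≤ (1 - 1/r) n^(2 - 2/p)`. -/
theorem pSpectralRadius_le_of_cliqueFree [Nonempty V] {p : ℝ} {r : ℕ} (hp : 1 < p) (hr : 2 ≤ r)
    {G : SimpleGraph V} (hG : G.CliqueFree (r + 1)) :
    pSpectralRadius p G ≤ (1 - 1 / r) * (Fintype.card V : ℝ) ^ (2 * (1 - 1 / p)) := by
  have hr' : (1 : ℝ) ≤ r := by exact_mod_cast (by lia : 1 ≤ r)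
  have hr1 : (0 : ℝ) ≤ 1 - 1 / r := by
    rw [sub_nonneg, div_le_one (by linarith)]; exact hr'
  obtain ⟨x, hx, hs, he⟩ := exists_nonneg_maximizer hp.le G
  rcases lt_or_ge (Fintype.card V) 2 with h2 | h2
  · have : quadForm G x = 0 := by
      classical
      have : Subsingleton V := Fintype.card_le_one_iff_subsingleton.1 (by lia)
      rw [quadForm_eq_sum]
      refine sum_eq_zero fun u _ => sum_eq_zero fun v _ => ?_
      rw [Subsingleton.elim v u]; simp
    rw [← he, this]
    positivity
  obtain ⟨H, y, h⟩ := exists_isExtremalPair (V := V) (r := r) hp.le (by lia)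
  obtain ⟨c, hc⟩ := h.exists_coloring (h.pos hp hr h2)
  have h1 := h.le G hG x
  simp only [abs_of_nonneg (hx _), hs, Real.one_rpow, mul_one] at h1
  rw [← he]
  refine h1.trans ((quadForm_coloring_le (by lia) hc y).trans ?_)
  refine mul_le_mul_of_nonneg_left ?_ hr1
  rw [mul_comm, Real.rpow_mul (by positivity), Real.rpow_two]
  exact pow_le_pow_left₀ (sum_nonneg fun v _ => h.nonneg v)
    (sum_rpow_le_card hp h.nonneg h.sum_eq.le) 2

end Extremal

/-! ### Balance of the classes and the spectral Turán theorem. -/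

section SpectralTuran

variable {V : Type*} [Fintype V]

theorem nbrSum_coloring {ι : Type*} [DecidableEq ι] {G : SimpleGraph V} {c : V → ι}
    (hc : ∀ u v, G.Adj u v ↔ c u ≠ c v) (x : V → ℝ) (u : V) :
    nbrSum G x u = ∑ v, x v - ∑ v with c v = c u, x v := by
  classical
  rw [nbrSum, sum_filter, ← sum_sub_distrib]
  refine sum_congr rfl fun v _ => ?_
  by_cases h : c u = c v
  · simp [hc, h]
  · simp [hc, h, Ne.symm h]

/-- Jensen: averaging `s` vertices of value `α` with `t` vertices of value `β` does not increase the
sum of p-th powers. -/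
theorem mul_rpow_div_le {p : ℝ} (hp : 1 ≤ p) {s t α β : ℝ} (hs : 0 ≤ s) (ht : 0 ≤ t)
    (hst : 0 < s + t) (hα : 0 ≤ α) (hβ : 0 ≤ β) :
    (s + t) * ((s * α + t * β) / (s + t)) ^ p ≤ s * α ^ p + t * β ^ p := by
  have h := (convexOn_rpow hp).2 (Set.mem_Ici.2 hα) (Set.mem_Ici.2 hβ)
    (show 0 ≤ s / (s + t) by positivity) (show 0 ≤ t / (s + t) by positivity) (by field_simp)
  simp only [smul_eq_mul] at h
  have e : s / (s + t) * α + t / (s + t) * β = (s * α + t * β) / (s + t) := by field_simp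
  rw [e] at h
  calc _ ≤ (s + t) * (s / (s + t) * α ^ p + t / (s + t) * β ^ p) :=
        mul_le_mul_of_nonneg_left h hst.le
    _ = _ := by field_simp

/-- If class `i` had two more vertices than class `j`, one vertex could be moved and both the sizes
and the weights of the two classes mixed in the same proportion. The total weight is kept, the
p-norm does not grow by Jensen, and the sum of squared class weights drops, so the form grows. -/
theorem IsExtremalPair.card_color_le {p : ℝ} {r : ℕ} {G : SimpleGraph V} {x : V → ℝ}
    (h : IsExtremalPair p r G x) (hp : 1 < p) (hM : 0 < quadForm G x) (hx : ∀ v, 0 < x v)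
    {c : V → Fin r} (hc : ∀ u v, G.Adj u v ↔ c u ≠ c v) (i j : Fin r) :
    #{v | c v = i} ≤ #{v | c v = j} + 1 := by
  classical
  by_contra! hlt
  have hij : i ≠ j := by rintro rfl; omega
  obtain ⟨v₀, hv₀⟩ : ∃ v, c v = i := by
    have : 0 < #{v | c v = i} := by omega
    obtain ⟨v, hv⟩ := card_pos.1 this
    exact ⟨v, (mem_filter.1 hv).2⟩
  set N : Fin r → ℝ := fun l => (#{v | c v = l} : ℝ) with hN
  -- Vertices of one class have the same neighbour sum, so the eigenvalue equation gives them the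
  -- same entry.
  have hfac : Function.FactorsThrough x c := by
    intro u v huv
    have h1 := nbrSum_coloring hc x u
    rw [huv, ← nbrSum_coloring hc x v, h.nbrSum_eq hp, h.nbrSum_eq hp] at h1
    exact (Real.rpow_left_inj (hx u).le (hx v).le (by linarith)).1 (mul_left_cancel₀ hM.ne' h1)
  set f : Fin r → ℝ := Function.extend c x 0 with hf
  have hfc : ∀ v, x v = f (c v) := fun v => (hfac.extend_apply 0 v).symm
  have hf0 : ∀ l, 0 ≤ f l := by
    intro l
    by_cases hl : ∃ v, c v = l
    · obtain ⟨v, rfl⟩ := hl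
      rw [← hfc]; exact (hx v).le
    · rw [hf, Function.extend_apply' _ _ _ hl]; rfl
  set c' : V → Fin r := Function.update c v₀ j with hc'
  set N' : Fin r → ℝ := fun l => (#{v | c' v = l} : ℝ) with hN'
  have hNi : N' i = N i - 1 := by
    have : ({v | c v = i} : Finset V) = insert v₀ ({v | c' v = i} : Finset V) := by
      ext v
      by_cases hv : v = v₀
      · subst hv; simp [hv₀]
      · simp [hc', hv]
    simp only [hN, hN']
    rw [this, card_insert_of_notMem (by simp [hc', hij.symm])]
    push_cast; ring
  have hNj : N' j = N j + 1 := by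
    have : ({v | c' v = j} : Finset V) = insert v₀ ({v | c v = j} : Finset V) := by
      ext v
      by_cases hv : v = v₀
      · subst hv; simp [hc']
      · simp [hc', hv]
    simp only [hN, hN']
    rw [this, card_insert_of_notMem (by simp [hv₀, hij])]
    push_cast; ring
  have hNl : ∀ l, l ≠ i → l ≠ j → N' l = N l := by
    intro l hli hlj
    simp only [hN, hN']
    congr 2
    ext v
    by_cases hv : v = v₀
    · subst hv; simp [hc', hv₀, hli.symm, hlj.symm]
    · simp [hc', hv]
  have hab : N j + 2 ≤ N i := by
    simp only [hN]; exact_mod_cast hlt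
  have hb : 0 ≤ N j := by simp [hN]
  -- This proportion makes (1 - t) N i + t N j equal to N i - 1, the size of class `i` after the
  -- move.
  set t : ℝ := 1 / (N i - N j) with ht
  have ht0 : 0 < t := by rw [ht]; apply one_div_pos.2; linarith
  have ht1 : t < 1 := by rw [ht, div_lt_one (by linarith)]; linarith
  have hteq : t * (N i - N j) = 1 := by
    rw [ht]; exact one_div_mul_cancel (by linarith)
  set g : Fin r → ℝ := Function.update (Function.update f i
    (((1 - t) * N i * f i + t * N j * f j) / (N i - 1))) j
    ((t * N i * f i + (1 - t) * N j * f j) / (N j + 1)) with hg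
  have hgi : g i = ((1 - t) * N i * f i + t * N j * f j) / (N i - 1) := by
    simp [hg, hij]
  have hgj : g j = (t * N i * f i + (1 - t) * N j * f j) / (N j + 1) := by
    simp [hg]
  have hgl : ∀ l, l ≠ i → l ≠ j → g l = f l := fun l hli hlj => by
    simp [hg, hli, hlj]
  have hwi : N' i * g i = (1 - t) * (N i * f i) + t * (N j * f j) := by
    rw [hNi, hgi, mul_div_cancel₀ _ (by linarith)]; ring
  have hwj : N' j * g j = t * (N i * f i) + (1 - t) * (N j * f j) := by
    rw [hNj, hgj, mul_div_cancel₀ _ (by linarith)]; ring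
  -- Equal class weights would give equal neighbour sums, hence equal entries and equal sizes. The
  -- drop in the sum of squares is therefore strict.
  have hne : N i * f i ≠ N j * f j := by
    intro he
    rcases hb.eq_or_lt with hb0 | hb0
    · rw [← hb0, zero_mul] at he
      have : 0 < f i := by rw [← hv₀, ← hfc]; exact hx v₀
      have h2 : 0 < N i * f i := mul_pos (by linarith) this
      linarith
    · obtain ⟨v₁, hv₁⟩ : ∃ v, c v = j := by
        have : 0 < #{v | c v = j} := by
          simp only [hN] at hb0; exact_mod_cast hb0
        obtain ⟨v, hv⟩ := card_pos.1 this
        exact ⟨v, (mem_filter.1 hv).2⟩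
      have hw : ∀ l, ∑ v with c v = l, x v = N l * f l := by
        intro l
        rw [sum_congr rfl (g := fun _ => f l) fun v hv => by rw [hfc, (mem_filter.1 hv).2]]
        simp [hN]
      have e1 := nbrSum_coloring hc x v₀
      have e2 := nbrSum_coloring hc x v₁
      rw [hv₀, hw, he, ← hw j, ← hv₁, ← e2, h.nbrSum_eq hp, h.nbrSum_eq hp] at e1
      have e3 := (Real.rpow_left_inj (hx _).le (hx _).le (by linarith)).1
        (mul_left_cancel₀ hM.ne' e1)
      have e4 := hx v₀
      rw [hfc v₀, hfc v₁, hv₀, hv₁] at e3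
      rw [hfc v₀, hv₀] at e4
      rw [← e3] at he
      have := mul_right_cancel₀ e4.ne' he
      linarith
  -- sums over the colours that agree off `i` and `j`
  have hsplit : ∀ A B : Fin r → ℝ, (∀ l, l ≠ i → l ≠ j → A l = B l) →
      ∑ l, A l - ∑ l, B l = (A i + A j) - (B i + B j) := by
    intro A B hAB
    rw [← sum_sub_distrib, ← sum_subset (subset_univ ({i, j} : Finset (Fin r))), sum_pair hij]
    · ring
    · intro l _ hl
      simp only [mem_insert, mem_singleton, not_or] at hl
      rw [hAB l hl.1 hl.2, sub_self]
  have hSx : ∑ v, x v = ∑ l, N l * f l := by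
    simp_rw [hfc]; exact sum_comp_coloring c f
  have hSg : ∑ v, g (c' v) = ∑ l, N' l * g l := sum_comp_coloring c' g
  have hwx : ∀ l, ∑ v with c v = l, x v = N l * f l := by
    intro l
    rw [sum_congr rfl (g := fun _ => f l) fun v hv => by rw [hfc, (mem_filter.1 hv).2]]
    simp [hN]
  have hwg : ∀ l, ∑ v with c' v = l, g (c' v) = N' l * g l := by
    intro l
    rw [sum_congr rfl (g := fun _ => g l) fun v hv => by rw [(mem_filter.1 hv).2]]
    simp [hN']
  have hS : ∑ l, N' l * g l = ∑ l, N l * f l := by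
    have := hsplit (fun l => N' l * g l) (fun l => N l * f l) fun l h1 h2 => by
      simp only [hNl l h1 h2, hgl l h1 h2]
    simp only [hwi, hwj] at this
    linarith
  let H : SimpleGraph V := (⊤ : SimpleGraph (Fin r)).comap c'
  have hH : ∀ u v, H.Adj u v ↔ c' u ≠ c' v := fun u v => by simp [H]
  have hq : quadForm G x < quadForm H (g ∘ c') := by
    rw [quadForm_coloring hc, quadForm_coloring hH]
    simp only [Function.comp_apply, hwx, hwg, hSx, hSg, hS]
    have := hsplit (fun l => (N' l * g l) ^ 2) (fun l => (N l * f l) ^ 2) fun l h1 h2 => by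
      simp only [hNl l h1 h2, hgl l h1 h2]
    simp only [hwi, hwj] at this
    have h2 : 0 < t * (1 - t) * (N i * f i - N j * f j) ^ 2 :=
      mul_pos (mul_pos ht0 (by linarith)) (sq_pos_of_ne_zero (sub_ne_zero.2 hne))
    linarith
  have hg0 : ∀ l, 0 ≤ g l := by
    intro l
    by_cases hl : l = j
    · subst hl; rw [hgj]
      have := hf0 i; have := hf0 l
      have : 0 ≤ 1 - t := by linarith
      have : 0 ≤ N i := by linarith
      positivity
    by_cases hl' : l = i
    · subst hl'; rw [hgi]
      have := hf0 l; have := hf0 j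
      have : 0 ≤ 1 - t := by linarith
      have : 0 ≤ N l := by linarith
      have : 0 ≤ N l - 1 := by linarith
      positivity
    rw [hgl l hl' hl]; exact hf0 l
  have hnorm : ∑ v, |(g ∘ c') v| ^ p ≤ 1 := by
    have h1 : ∑ v, |(g ∘ c') v| ^ p = ∑ l, N' l * g l ^ p := by
      rw [← sum_comp_coloring c' fun l => g l ^ p]
      exact sum_congr rfl fun v _ => by rw [Function.comp_apply, abs_of_nonneg (hg0 _)]
    have h2 : ∑ l, N l * f l ^ p = 1 := by
      rw [← sum_comp_coloring c fun l => f l ^ p, ← h.sum_eq]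
      exact sum_congr rfl fun v _ => by rw [hfc]
    have h3 := hsplit (fun l => N' l * g l ^ p) (fun l => N l * f l ^ p) fun l h1 h2 => by
      simp only [hNl l h1 h2, hgl l h1 h2]
    have ei : (1 - t) * N i + t * N j = N i - 1 := by linarith
    have ej : t * N i + (1 - t) * N j = N j + 1 := by linarith
    have hti : 0 ≤ (1 - t) * N i := mul_nonneg (by linarith) (by linarith)
    have htj : 0 ≤ (1 - t) * N j := mul_nonneg (by linarith) hb
    have hti' : 0 ≤ t * N i := mul_nonneg ht0.le (by linarith)
    have htj' : 0 ≤ t * N j := mul_nonneg ht0.le hb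
    have h4 := mul_rpow_div_le hp.le hti htj' (by linarith) (hf0 i) (hf0 j)
    have h5 := mul_rpow_div_le hp.le hti' htj (by linarith) (hf0 i) (hf0 j)
    rw [ei, ← hgi, ← hNi] at h4
    rw [ej, ← hgj, ← hNj] at h5
    rw [h1]
    linarith
  have h6 := h.le H (cliqueFree_of_coloring fun u v => (hH u v).1) (g ∘ c')
  have h7 : (∑ v, |(g ∘ c') v| ^ p) ^ (2 / p) ≤ 1 :=
    Real.rpow_le_one (sum_nonneg fun v _ => by positivity) hnorm (by positivity)
  have h8 := mul_le_mul_of_nonneg_left h7 hM.le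
  linarith

/-- A complete multipartite graph with `r` balanced, possibly empty, parts is a Turán graph. -/
theorem nonempty_iso_turanGraph_of_coloring {r : ℕ} {G : SimpleGraph V} {c : V → Fin r}
    (hc : ∀ u v, G.Adj u v ↔ c u ≠ c v)
    (hbal : ∀ i j, #{v | c v = i} ≤ #{v | c v = j} + 1) :
    Nonempty (G ≃g SimpleGraph.turanGraph (Fintype.card V) r) := by
  classical
  -- Classes may be empty only when `c` is injective, and then both graphs are complete. Otherwise
  -- some class has two vertices and balance leaves no class empty.
  by_cases hinj : Function.Injective c
  · have hcard : Fintype.card V ≤ r := by simpa using Fintype.card_le_of_injective c hinj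
    rw [SimpleGraph.turanGraph_eq_top.2 (Or.inr hcard)]
    refine ⟨⟨Fintype.equivFin V, fun {a b} => ?_⟩⟩
    rw [hc, hinj.ne_iff]; simp
  have hsurj : Function.Surjective c := by
    obtain ⟨a, b, hab, hne⟩ : ∃ a b, c a = c b ∧ a ≠ b := by
      simpa [Function.Injective] using hinj
    intro j
    have h2 : 2 ≤ #{v | c v = c a} := by
      rw [← card_pair hne]
      exact card_le_card (by intro v; simp; rintro (rfl | rfl) <;> simp [hab])
    have h3 := hbal (c a) j
    obtain ⟨v, hv⟩ := card_pos.1 (show 0 < #{v | c v = j} by omega)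
    exact ⟨v, (mem_filter.1 hv).2⟩
  let P : Finpartition (univ : Finset V) := Finpartition.ofSetoid (Setoid.ker c)
  have hpart : ∀ a, P.part a = ({v | c v = c a} : Finset V) := by
    intro a
    ext v
    rw [Finpartition.mem_part_ofSetoid_iff_rel]
    simp [Setoid.ker_def, eq_comm]
  have hparts : ∀ s, s ∈ P.parts ↔ ∃ i, s = ({v | c v = i} : Finset V) := by
    intro s
    constructor
    · intro hs
      obtain ⟨a, ha⟩ := P.nonempty_of_mem_parts hs
      exact ⟨c a, by rw [← hpart, P.part_eq_of_mem hs ha]⟩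
    · rintro ⟨i, rfl⟩
      obtain ⟨a, rfl⟩ := hsurj i
      rw [← hpart]
      exact P.part_mem.2 (mem_univ a)
  have hcardP : #P.parts = r := by
    have : P.parts = univ.image fun i => ({v | c v = i} : Finset V) := by
      ext s; rw [hparts]; simp [eq_comm]
    rw [this, card_image_of_injective, card_univ, Fintype.card_fin]
    intro i j hij
    obtain ⟨a, rfl⟩ := hsurj i
    have : a ∈ ({v | c v = j} : Finset V) := by
      have hij' : ({v | c v = c a} : Finset V) = ({v | c v = j} : Finset V) := hij
      rw [← hij']; simp
    exact (mem_filter.1 this).2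
  have heq : P.IsEquipartition := by
    intro s t hs ht
    obtain ⟨i, rfl⟩ := (hparts s).1 hs
    obtain ⟨j, rfl⟩ := (hparts t).1 ht
    exact hbal i j
  obtain ⟨f, hf⟩ := heq.exists_partPreservingEquiv
  rw [hcardP] at hf
  refine ⟨⟨(Equiv.subtypeUnivEquiv mem_univ).symm.trans f, fun {a b} => ?_⟩⟩
  have h1 := hf ⟨a, mem_univ a⟩ ⟨b, mem_univ b⟩
  have h2 : P.part a = P.part b ↔ c a = c b := by
    rw [hpart, hpart]
    constructor
    · intro h
      have : a ∈ ({v | c v = c b} : Finset V) := by rw [← h]; simp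
      exact (mem_filter.1 this).2
    · intro h; rw [h]
  rw [hc, ← h2.ne, SimpleGraph.turanGraph_adj]
  exact not_congr h1.symm

/-- **Turán's theorem** for the `p`-spectral radius. -/
theorem IsExtremalPair.nonempty_iso_turanGraph {p : ℝ} {r : ℕ} {G : SimpleGraph V} {x : V → ℝ}
    (h : IsExtremalPair p r G x) (hp : 1 < p) (hr : 2 ≤ r) :
    Nonempty (G ≃g SimpleGraph.turanGraph (Fintype.card V) r) := by
  rcases lt_or_ge (Fintype.card V) 2 with h2 | h2
  · rw [SimpleGraph.turanGraph_eq_top.2 (Or.inr (by lia))]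
    have : Subsingleton V := Fintype.card_le_one_iff_subsingleton.1 (by lia)
    refine ⟨⟨Fintype.equivFin V, fun {a b} => ?_⟩⟩
    rw [Subsingleton.elim a b]; simp
  · have hx := h.pos hp hr h2
    obtain ⟨c, hc⟩ := h.exists_coloring hx
    exact nonempty_iso_turanGraph_of_coloring hc (h.card_color_le hp (h.quadForm_pos hr h2) hx hc)

/-- The extremal value is that of the Turán graph, so `G` with its own maximizer is an extremal pair
and the structure theorem applies to `G` itself. -/
theorem nonempty_iso_turanGraph_of_le {p : ℝ} {r : ℕ} (hp : 1 < p) (hr : 2 ≤ r) [Nonempty V]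
    {G : SimpleGraph V} (hG : G.CliqueFree (r + 1))
    (hle : pSpectralRadius p (SimpleGraph.turanGraph (Fintype.card V) r) ≤ pSpectralRadius p G) :
    Nonempty (G ≃g SimpleGraph.turanGraph (Fintype.card V) r) := by
  obtain ⟨H, y, h⟩ := exists_isExtremalPair (V := V) (r := r) hp.le (by lia)
  obtain ⟨f⟩ := h.nonempty_iso_turanGraph hp hr
  rw [← pSpectralRadius_iso f] at hle
  obtain ⟨x, hx, hs, he⟩ := exists_nonneg_maximizer hp.le G
  have h1 : quadForm H y ≤ quadForm G x := by
    rw [he]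
    refine le_trans ?_ hle
    have := quadForm_le_pSpectralRadius hp.le H y
    simpa [abs_of_nonneg (h.nonneg _), h.sum_eq] using this
  have h2 : IsExtremalPair p r G x := by
    refine ⟨hG, hx, hs, fun K hK z => (h.le K hK z).trans ?_⟩
    exact mul_le_mul_of_nonneg_right h1
      (Real.rpow_nonneg (sum_nonneg fun v _ => Real.rpow_nonneg (abs_nonneg _) _) _)
  exact h2.nonempty_iso_turanGraph hp hr

end SpectralTuran

/-! ### A lower bound for the Turán graph. -/

section TuranBound

/-- Test with the all-ones vector: each class size is within 1 of n/r, so the squares of the sizes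
sum to at most n²/r + r. -/
theorem le_pSpectralRadius_turanGraph {p : ℝ} {r n : ℕ} (hp : 1 < p) (hr : 2 ≤ r) (hn : 2 ≤ n) :
    (1 - 1 / r - r / (n : ℝ) ^ 2) * (n : ℝ) ^ (2 * (1 - 1 / p)) ≤
      pSpectralRadius p (SimpleGraph.turanGraph n r) := by
  have hr0 : (0 : ℝ) < r := by exact_mod_cast (by lia : 0 < r)
  have hn0 : (0 : ℝ) < n := by exact_mod_cast (by lia : 0 < n)
  have hp0 : 0 < p := by linarith
  have : Nonempty (Fin n) := ⟨⟨0, by lia⟩⟩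
  have hcard : 2 ≤ Fintype.card (Fin n) := by simpa using hn
  obtain ⟨H, y, h⟩ := exists_isExtremalPair (V := Fin n) (r := r) hp.le (by lia)
  obtain ⟨f⟩ := h.nonempty_iso_turanGraph hp hr
  rw [Fintype.card_fin] at f
  rw [← pSpectralRadius_iso f]
  have hy := h.pos hp hr hcard
  obtain ⟨c, hc⟩ := h.exists_coloring hy
  have hbal := h.card_color_le hp (h.quadForm_pos hr hcard) hy hc
  set N : Fin r → ℝ := fun i => (#{v | c v = i} : ℝ) with hN
  have hNsum : ∑ i, N i = n := by
    have := sum_comp_coloring c fun _ => (1 : ℝ)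
    simpa using this.symm
  have hbalR : ∀ i j, N i ≤ N j + 1 := fun i j => by
    simp only [hN]; exact_mod_cast hbal i j
  have hdev : ∀ i, (N i - n / r) ^ 2 ≤ 1 := by
    intro i
    have h1 : ∑ j : Fin r, N i ≤ ∑ j, (N j + 1) := sum_le_sum fun j _ => hbalR i j
    have h2 : ∑ j, N j ≤ ∑ j : Fin r, (N i + 1) := sum_le_sum fun j _ => hbalR j i
    simp only [sum_add_distrib, hNsum, sum_const, card_univ, Fintype.card_fin, nsmul_eq_mul,
      mul_one] at h1 h2
    rw [sq_le_one_iff_abs_le_one, abs_le]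
    have e : (n : ℝ) / r * r = n := div_mul_cancel₀ _ hr0.ne'
    constructor <;> nlinarith
  have hsq : ∑ i, N i ^ 2 ≤ (n : ℝ) ^ 2 / r + r := by
    have h1 : ∑ i, (N i - n / r) ^ 2 ≤ ∑ i : Fin r, (1 : ℝ) := sum_le_sum fun i _ => hdev i
    have h2 : ∀ i, (N i - n / r) ^ 2 = N i ^ 2 - 2 * (n / r) * N i + (n / r) ^ 2 := fun i => by ring
    simp_rw [h2, sum_add_distrib, sum_sub_distrib, ← mul_sum, hNsum] at h1
    simp only [sum_const, card_univ, Fintype.card_fin, nsmul_eq_mul, mul_one] at h1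
    have e : (r : ℝ) * (n / r) ^ 2 = n ^ 2 / r := by field_simp
    have e' : 2 * ((n : ℝ) / r) * n = 2 * (n ^ 2 / r) := by ring
    linarith
  have hq : (1 - 1 / r) * (n : ℝ) ^ 2 - r ≤ quadForm H (fun _ => 1) := by
    rw [quadForm_coloring hc]
    simp only [sum_const, nsmul_eq_mul, mul_one, card_univ, Fintype.card_fin]
    have e : (1 - 1 / (r : ℝ)) * (n : ℝ) ^ 2 = n ^ 2 - n ^ 2 / r := by ring
    rw [e]
    linarith
  have hle := quadForm_le_pSpectralRadius hp.le H (fun _ => 1)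
  simp only [abs_one, Real.one_rpow, sum_const, nsmul_eq_mul, mul_one, card_univ,
    Fintype.card_fin] at hle
  have hsplit : (n : ℝ) ^ 2 = (n : ℝ) ^ (2 * (1 - 1 / p)) * (n : ℝ) ^ (2 / p) := by
    rw [← Real.rpow_add hn0, ← Real.rpow_two]
    congr 1; ring
  have hpos : 0 < (n : ℝ) ^ (2 / p) := by positivity
  refine le_of_mul_le_mul_right ?_ hpos
  refine le_trans (le_of_eq ?_) (hq.trans hle)
  rw [mul_assoc, ← hsplit]
  field_simp

end TuranBound

/-! ### Joints and clique counting under a minimum degree condition. -/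

section Joints

variable {V : Type*} [Fintype V]

theorem card_le_jointSize {G : SimpleGraph V} {r : ℕ} {C : Finset (Finset V)}
    (hC : IsJoint G r C) : #C ≤ jointSize G r := by
  refine le_csSup ⟨Fintype.card (Finset V), ?_⟩ ⟨C, hC, rfl⟩
  rintro t ⟨D, -, rfl⟩
  exact card_le_univ D

theorem jointSize_pos {G : SimpleGraph V} {r : ℕ} (hr : 2 ≤ r) (hG : ¬ G.CliqueFree r) :
    0 < jointSize G r := by
  obtain ⟨K, hK⟩ : ∃ K, G.IsNClique r K := by simpa [SimpleGraph.CliqueFree] using hG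
  obtain ⟨u, hu, v, hv, huv⟩ := one_lt_card.1 (show 1 < #K by rw [hK.card_eq]; lia)
  have := card_le_jointSize (G := G) (r := r) (C := {K})
    ⟨u, v, hK.isClique hu hv huv, by simp [hK, hu, hv]⟩
  rwa [card_singleton] at this

theorem jointSize_le_of_embedding {W : Type*} [Fintype W] {G : SimpleGraph V} {H : SimpleGraph W}
    (f : H ↪g G) (r : ℕ) : jointSize H r ≤ jointSize G r := by
  refine csSup_le' ?_
  rintro t ⟨C, ⟨u, v, huv, hC⟩, rfl⟩
  rw [← card_map (mapEmbedding f.toEmbedding).toEmbedding]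
  refine card_le_jointSize ⟨f u, f v, f.map_adj_iff.2 huv, ?_⟩
  intro K hK
  obtain ⟨K, hK', rfl⟩ := mem_map.1 hK
  obtain ⟨h1, h2, h3⟩ := hC K hK'
  refine ⟨?_, ?_, ?_⟩
  · refine ⟨?_, ?_⟩
    · intro a ha b hb hab
      obtain ⟨a, ha', rfl⟩ := mem_map.1 (mem_coe.1 ha)
      obtain ⟨b, hb', rfl⟩ := mem_map.1 (mem_coe.1 hb)
      exact f.map_adj_iff.2 (h1.isClique ha' hb' fun h => hab (by rw [h]))
    · simpa using h1.card_eq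
  · exact mem_map_of_mem f.toEmbedding h2
  · exact mem_map_of_mem f.toEmbedding h3

open Classical in
/-- The cliques of `G` on `m` vertices that lie in `A`. -/
noncomputable def cliquesIn (G : SimpleGraph V) (m : ℕ) (A : Finset V) : Finset (Finset V) :=
  {K | G.IsNClique m K ∧ K ⊆ A}

theorem mem_cliquesIn {G : SimpleGraph V} {m : ℕ} {A K : Finset V} :
    K ∈ cliquesIn G m A ↔ G.IsNClique m K ∧ K ⊆ A := by
  simp [cliquesIn]

/-- Adding `a` to a clique in its neighbourhood gives a clique with one more vertex, and each of
these arises at most once for every choice of `a` among its m + 1 vertices. -/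
theorem sum_card_cliquesIn_le [DecidableEq V] (G : SimpleGraph V) [DecidableRel G.Adj] (m : ℕ)
    (A : Finset V) :
    ∑ a ∈ A, #(cliquesIn G m (G.neighborFinset a ∩ A)) ≤ (m + 1) * #(cliquesIn G (m + 1) A) := by
  rw [← card_sigma]
  have hnot : ∀ a K, K ∈ cliquesIn G m (G.neighborFinset a ∩ A) → a ∉ K := by
    intro a K hK ha
    have := (mem_cliquesIn.1 hK).2 ha
    simp at this
  refine card_le_mul_card_image_of_maps_to (f := fun q : (_ : V) × Finset V => insert q.1 q.2)
    ?_ _ ?_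
  · rintro ⟨a, K⟩ h
    obtain ⟨ha, hK⟩ := mem_sigma.1 h
    have hK' := mem_cliquesIn.1 hK
    refine mem_cliquesIn.2 ⟨hK'.1.insert fun b hb => ?_, insert_subset ha fun b hb => ?_⟩
    · simpa using (mem_inter.1 (hK'.2 hb)).1
    · exact (mem_inter.1 (hK'.2 hb)).2
  · intro L hL
    rw [← (mem_cliquesIn.1 hL).1.card_eq]
    refine card_le_card_of_injOn (fun q => q.1) ?_ ?_
    · rintro ⟨a, K⟩ h
      simp only [coe_filter, Set.mem_ofPred_eq] at h
      rw [← h.2]; simp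
    · rintro ⟨a, K⟩ h ⟨b, K'⟩ h' hab
      simp only [coe_filter, Set.mem_ofPred_eq, mem_sigma] at h h' hab
      subst hab
      have e := h.2.trans h'.2.symm
      rw [← erase_insert (hnot a K h.1.2), ← erase_insert (hnot a K' h'.1.2), e]

/-- Passing to the neighbourhood of a vertex of `A` costs at most βk vertices, so at least δk
candidates remain at each of the m + 1 choices; the factorial removes the order. -/
theorem le_card_cliquesIn (G : SimpleGraph V) [DecidableRel G.Adj] {β δ k : ℝ}
    (hk : k = Fintype.card V) (hβ : 0 ≤ β) (hδ : 0 ≤ δ)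
    (hdeg : ∀ v, (1 - β) * k ≤ G.degree v) (m : ℕ) (A : Finset V)
    (hA : (m * β + δ) * k ≤ #A) :
    (δ * k) ^ (m + 1) / (m + 1).factorial ≤ #(cliquesIn G (m + 1) A) := by
  classical
  have hk0 : 0 ≤ k := by rw [hk]; positivity
  induction m generalizing A with
  | zero =>
    have h := sum_card_cliquesIn_le G 0 A
    have h1 : ∀ a ∈ A, 1 ≤ #(cliquesIn G 0 (G.neighborFinset a ∩ A)) := by
      intro a _
      refine card_pos.2 ⟨∅, mem_cliquesIn.2 ⟨by simp, by simp⟩⟩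
    have h2 := (card_nsmul_le_sum A _ 1 h1).trans h
    have h3 : (#A : ℝ) ≤ #(cliquesIn G (0 + 1) A) := by
      have : #A ≤ #(cliquesIn G (0 + 1) A) := by simpa using h2
      exact_mod_cast this
    simp at hA ⊢
    simpa using hA.trans h3
  | succ m ih =>
    have h : ∑ a ∈ A, (#(cliquesIn G (m + 1) (G.neighborFinset a ∩ A)) : ℝ) ≤
        ((m + 1 + 1 : ℕ) : ℝ) * #(cliquesIn G (m + 1 + 1) A) := by
      exact_mod_cast sum_card_cliquesIn_le G (m + 1) A
    have h1 : ∀ a ∈ A, (δ * k) ^ (m + 1) / (m + 1).factorial ≤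
        (#(cliquesIn G (m + 1) (G.neighborFinset a ∩ A)) : ℝ) := by
      intro a _
      refine ih _ ?_
      have e : #(G.neighborFinset a ∪ A) + #(G.neighborFinset a ∩ A) = G.degree a + #A := by
        rw [card_union_add_card_inter, SimpleGraph.card_neighborFinset_eq_degree]
      have e' : (#(G.neighborFinset a ∪ A) : ℝ) ≤ k := by
        rw [hk]; exact_mod_cast card_le_univ _
      have e'' : (#(G.neighborFinset a ∪ A) : ℝ) + #(G.neighborFinset a ∩ A) =
        G.degree a + #A := by exact_mod_cast e
      have := hdeg a
      push_cast at hA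
      linarith
    have h2 := card_nsmul_le_sum A _ _ h1
    rw [nsmul_eq_mul] at h2
    have h3 : δ * k ≤ #A := le_trans (by
      have : 0 ≤ ((m + 1 : ℕ) : ℝ) * β * k := by positivity
      linarith) hA
    have hf : (0 : ℝ) ≤ (δ * k) ^ (m + 1) / (m + 1).factorial := by positivity
    have h4 := (mul_le_mul_of_nonneg_right h3 hf).trans (h2.trans h)
    have hm : (0 : ℝ) < ((m + 1 + 1 : ℕ) : ℝ) := by positivity
    rw [Nat.factorial_succ (m + 1), Nat.cast_mul, div_le_iff₀ (by positivity)]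
    have e : (δ * k) ^ (m + 1 + 1) = δ * k * ((δ * k) ^ (m + 1) / (m + 1).factorial) *
        (m + 1).factorial := by
      field_simp
      ring
    rw [e]
    have := mul_le_mul_of_nonneg_right h4 (show (0 : ℝ) ≤ (m + 1).factorial by positivity)
    linarith

/-- In a graph of large minimum degree, some edge of a given clique on `r + 1` vertices has many
common neighbours. -/
theorem exists_pair_common_neighbors [DecidableEq V] (G : SimpleGraph V) [DecidableRel G.Adj]
    {r : ℕ} (hr : 1 ≤ r) {β T k : ℝ} (hk : k = Fintype.card V)
    (hdeg : ∀ v, (1 - β) * k ≤ G.degree v) {Q : Finset V} (hQ : #Q = r + 1)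
    (hT : r * (r + 1) * T ≤ (2 * (r - 1) * (r + 1) * (1 - β) - r * (r - 1)) * k) :
    ∃ u ∈ Q, ∃ v ∈ Q, u ≠ v ∧ T ≤ #(G.neighborFinset u ∩ G.neighborFinset v) := by
  by_contra! hcon
  have hrR : (1 : ℝ) ≤ r := by exact_mod_cast hr
  let a : V → V → ℝ := fun u w => if G.Adj u w then 1 else 0
  have hdega : ∀ u, ∑ w, a u w = G.degree u := by
    intro u
    simp [a, ← SimpleGraph.card_neighborFinset_eq_degree, SimpleGraph.neighborFinset_eq_filter]
  have hcomm : ∀ u v, ∑ w, a u w * a v w = #(G.neighborFinset u ∩ G.neighborFinset v) := by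
    intro u v
    have : G.neighborFinset u ∩ G.neighborFinset v = ({w | G.Adj u w ∧ G.Adj v w} : Finset V) := by
      ext w; simp
    rw [this, ← sum_boole]
    refine sum_congr rfl fun w _ => ?_
    by_cases h1 : G.Adj u w <;> by_cases h2 : G.Adj v w <;> simp [a, h1, h2]
  -- Double counting: common neighbourhoods, summed over ordered pairs in `Q`, count each vertex by
  -- the square of its degree into `Q`.
  have hsq : ∑ u ∈ Q, ∑ v ∈ Q, ∑ w, a u w * a v w = ∑ w, (∑ u ∈ Q, a u w) ^ 2 := by
    simp_rw [sq, sum_mul_sum]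
    conv_rhs => rw [sum_comm]
    exact sum_congr rfl fun u _ => sum_comm
  have hlin : ∑ w, ∑ u ∈ Q, a u w = ∑ u ∈ Q, (G.degree u : ℝ) := by
    rw [sum_comm]; exact sum_congr rfl fun u _ => hdega u
  have hD : (r + 1) * ((1 - β) * k) ≤ ∑ u ∈ Q, (G.degree u : ℝ) := by
    have := card_nsmul_le_sum Q _ _ fun u _ => hdeg u
    rw [hQ, nsmul_eq_mul] at this
    push_cast at this
    exact this
  have hupper : ∑ u ∈ Q, ∑ v ∈ Q, ∑ w, a u w * a v w <
      ∑ u ∈ Q, (G.degree u + r * T) := by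
    refine sum_lt_sum_of_nonempty (card_pos.1 (by lia)) fun u hu => ?_
    rw [← add_sum_erase _ _ hu]
    have h1 : ∑ w, a u w * a u w = G.degree u := by
      rw [← hdega]
      exact sum_congr rfl fun w _ => by by_cases h : G.Adj u w <;> simp [a, h]
    have hcard : #(Q.erase u) = r := by rw [card_erase_of_mem hu, hQ]; rfl
    have h2 : ∑ v ∈ Q.erase u, ∑ w, a u w * a v w < ∑ v ∈ Q.erase u, T := by
      refine sum_lt_sum_of_nonempty (card_pos.1 (by lia)) fun v hv => ?_
      rw [hcomm]
      exact hcon u hu v (mem_of_mem_erase hv) (ne_of_mem_erase hv).symm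
    rw [sum_const, hcard, nsmul_eq_mul] at h2
    rw [h1]
    linarith
  have hlower : ∑ w, ((2 * r - 1) * (∑ u ∈ Q, a u w) - r * (r - 1)) ≤
      ∑ w, (∑ u ∈ Q, a u w) ^ 2 := by
    refine sum_le_sum fun w _ => ?_
    obtain ⟨c, hc⟩ : ∃ c : ℕ, ∑ u ∈ Q, a u w = c := ⟨_, sum_boole _ _⟩
    rw [hc]
    -- No integer lies strictly between r - 1 and r. This yields c² ≥ (2r - 1)c - r(r - 1), with
    -- equality at c = r - 1 and c = r.
    have hint : (0 : ℤ) ≤ ((c : ℤ) - r) * (c - r + 1) := by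
      rcases le_or_gt (r : ℤ) c with h | h
      · exact mul_nonneg (by lia) (by lia)
      · exact mul_nonneg_of_nonpos_of_nonpos (by lia) (by lia)
    have hR : (0 : ℝ) ≤ ((c : ℝ) - r) * (c - r + 1) := by exact_mod_cast hint
    linarith
  rw [sum_sub_distrib, ← mul_sum, hlin] at hlower
  rw [hsq, sum_add_distrib] at hupper
  simp only [sum_const, card_univ, nsmul_eq_mul, hQ, ← hk] at hlower hupper
  push_cast at hupper
  have h5 := mul_le_mul_of_nonneg_left hD (show (0 : ℝ) ≤ 2 * (r - 1) by linarith)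
  linarith

/-- A graph of large minimum degree that has a clique on `r + 1` vertices has a large joint. -/
theorem le_jointSize_of_minDegree (G : SimpleGraph V) [DecidableRel G.Adj] {r : ℕ} (hr : 2 ≤ r)
    {β δ k : ℝ} (hk : k = Fintype.card V) (hβ : 0 ≤ β) (hδ : 0 ≤ δ)
    (hdeg : ∀ v, (1 - β) * k ≤ G.degree v) (hG : ¬ G.CliqueFree (r + 1))
    (hβδ : r * (r + 1) * ((r - 2) * β + δ) ≤ 2 * (r - 1) * (r + 1) * (1 - β) - r * (r - 1)) :
    (δ * k) ^ (r - 1) / (r - 1).factorial ≤ jointSize G (r + 1) := by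
  classical
  have hk0 : 0 ≤ k := by rw [hk]; positivity
  obtain ⟨Q, hQ⟩ : ∃ K, G.IsNClique (r + 1) K := by simpa [SimpleGraph.CliqueFree] using hG
  obtain ⟨m, rfl⟩ : ∃ m, r = m + 2 := ⟨r - 2, by lia⟩
  obtain ⟨u, hu, v, hv, huv, hT⟩ := exists_pair_common_neighbors G (r := m + 2) (by lia)
    (T := (m * β + δ) * k) hk hdeg hQ.card_eq (by
      have := mul_le_mul_of_nonneg_right hβδ hk0
      push_cast at this ⊢
      linarith)
  have h1 := le_card_cliquesIn G hk hβ hδ hdeg m _ hT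
  have hadj : G.Adj u v := hQ.isClique hu hv huv
  set W := G.neighborFinset u ∩ G.neighborFinset v with hW
  have huW : u ∉ W := by simp [hW]
  have hvW : v ∉ W := by simp [hW]
  have hinj : Set.InjOn (fun K => insert u (insert v K)) (cliquesIn G (m + 1) W : Set (Finset V)) := by
    intro K hK L hL hKL
    have hK' := (mem_cliquesIn.1 hK).2
    have hL' := (mem_cliquesIn.1 hL).2
    have e : ∀ M : Finset V, M ⊆ W → ((insert u (insert v M)).erase u).erase v = M := by
      intro M hM
      rw [erase_insert, erase_insert]
      · exact fun h => hvW (hM h)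
      · simp only [mem_insert, not_or]
        exact ⟨huv, fun h => huW (hM h)⟩
    rw [← e K hK', ← e L hL']
    simp only at hKL
    rw [hKL]
  have h2 := card_le_jointSize (G := G) (r := m + 2 + 1)
    (C := (cliquesIn G (m + 1) W).image fun K => insert u (insert v K)) ⟨u, v, hadj, by
      intro K hK
      obtain ⟨L, hL, rfl⟩ := mem_image.1 hK
      obtain ⟨hL1, hL2⟩ := mem_cliquesIn.1 hL
      refine ⟨(hL1.insert fun b hb => ?_).insert fun b hb => ?_, by simp, by simp⟩
      · simpa using (mem_inter.1 (hL2 hb)).2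
      · rcases mem_insert.1 hb with rfl | hb
        · exact hadj
        · simpa using (mem_inter.1 (hL2 hb)).1⟩
  rw [card_image_of_injOn hinj] at h2
  refine h1.trans ?_
  exact_mod_cast h2

end Joints

/-! ### Stability under vertex deletion forces large minimum degree. -/

section MinDegree

theorem add_sub_le_sq {a b c Y : ℝ} (ha : 0 ≤ a) (hb : 0 ≤ b) (ha1 : a ≤ 1) (hab : a + b ≤ c)
    (h : 1 - 2 * Y ≤ (1 - b) ^ 2 * (1 - a) ^ 2) : a + b - Y ≤ c ^ 2 := by
  have h1 : (a + b) ^ 2 ≤ c ^ 2 := pow_le_pow_left₀ (by linarith) hab 2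
  have h2 := sq_nonneg (a - b)
  have h3 : 0 ≤ a * b * a := mul_nonneg (mul_nonneg ha hb) ha
  have h4 : 0 ≤ a * b * b * (2 - a) := mul_nonneg (mul_nonneg (mul_nonneg ha hb) hb) (by linarith)
  have h5 := sq_nonneg (a + b)
  have e : (1 - b) ^ 2 * (1 - a) ^ 2 =
      1 - 2 * (a + b) + (a + b) ^ 2 + 2 * (a * b) - 2 * (a * b * a) - a * b * b * (2 - a) := by
    ring
  have e2 : (a - b) ^ 2 = (a + b) ^ 2 - 4 * (a * b) := by ring
  linarith

variable {V : Type*} [Fintype V]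

theorem nbrSum_eq_sum_neighborFinset (G : SimpleGraph V) [DecidableRel G.Adj] (x : V → ℝ) (u : V) :
    nbrSum G x u = ∑ v ∈ G.neighborFinset u, x v := by
  rw [nbrSum, G.neighborFinset_eq_filter, sum_filter]
  refine sum_congr rfl fun v _ => ?_
  split_ifs <;> rfl

/-- If deleting any vertex lowers the `p`-spectral radius by a factor of at least
`(1 - 1/k)^(2q(1-η))`, then all degrees are large. -/
theorem le_degree_of_forall_deletion [Nonempty V] (G : SimpleGraph V) [DecidableRel G.Adj]
    {p q η k φ : ℝ} (hp : 1 < p) (hq : q = 1 - 1 / p) (hη0 : 0 ≤ η) (hη1 : η ≤ 1)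
    (hk : k = Fintype.card V) (hk1 : 1 ≤ k) (hφ0 : 0 < φ)
    (hφ : pSpectralRadius p G = φ * k ^ (2 * q))
    (hdel : ∀ (u : V) (y : V → ℝ), y u = 0 → quadForm G y ≤
      pSpectralRadius p G * (1 - 1 / k) ^ (2 * q * (1 - η)) * (∑ v, |y v| ^ p) ^ (2 / p))
    (w : V) : (φ - 2 * (η + 1 / (q * k))) * k ≤ G.degree w := by
  classical
  have hp0 : 0 < p := by linarith
  have hq0 : 0 < q := by
    rw [hq, sub_pos, div_lt_one hp0]; exact hp
  have hpq : 1 / p = 1 - q := by rw [hq]; ring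
  have hq1 : 0 < 1 - q := by rw [← hpq]; positivity
  have hk0 : 0 < k := by linarith
  set M := pSpectralRadius p G with hMdef
  have hM : 0 < M := by rw [hφ]; positivity
  obtain ⟨x, hx, hs, he⟩ := exists_nonneg_maximizer hp.le G
  have heig : ∀ v, nbrSum G x v = M * x v ^ (p - 1) := fun v =>
    nbrSum_eq_of_forall_le hp hx hs he (quadForm_le_pSpectralRadius hp.le G) v
  obtain ⟨u, -, hu⟩ := exists_min_image univ x univ_nonempty
  set Y := x u ^ p with hY
  have hY0 : 0 ≤ Y := Real.rpow_nonneg (hx u) _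
  have hYle : ∀ v, Y ≤ x v ^ p := fun v =>
    Real.rpow_le_rpow (hx u) (hu v (mem_univ v)) hp0.le
  have hkY : k * Y ≤ 1 := by
    have := card_nsmul_le_sum univ (fun v => x v ^ p) Y fun v _ => hYle v
    rwa [hs, card_univ, nsmul_eq_mul, ← hk] at this
  have hY1 : Y ≤ 1 := (le_mul_of_one_le_left hY0 hk1).trans hkY
  have hpow : x u ^ (p - 1) = Y ^ q := by
    rw [hY, ← Real.rpow_mul (hx u), hq]
    congr 1; field_simp
  have hxpow : x u * x u ^ (p - 1) = Y := by
    rcases (hx u).eq_or_lt with h | h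
    · rw [hY, ← h, Real.zero_rpow hp0.ne', zero_mul]
    · nth_rewrite 1 [← Real.rpow_one (x u)]
      rw [← Real.rpow_add h, hY]; ring_nf
  -- deletion of the vertex with the smallest entry
  have h1 : 1 - 2 * Y ≤ (1 - 1 / k) ^ (2 * q * (1 - η)) * (1 - Y) ^ (2 / p) := by
    have h := hdel u (Function.update x u 0) (by simp)
    rw [quadForm_update, he, heig] at h
    have hN : ∑ v, |Function.update x u 0 v| ^ p = 1 - Y := by
      rw [← add_sum_erase _ _ (mem_univ u), ← hs, ← add_sum_erase _ (fun v => x v ^ p) (mem_univ u)]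
      rw [sum_congr rfl (g := fun v => x v ^ p) fun v hv => by
        rw [Function.update_of_ne (ne_of_mem_erase hv), abs_of_nonneg (hx v)]]
      simp [Real.zero_rpow hp0.ne', hY]
    rw [hN] at h
    have e : pSpectralRadius p G + 2 * (0 - x u) * (M * x u ^ (p - 1)) =
        M * (1 - 2 * (x u * x u ^ (p - 1))) := by rw [← hMdef]; ring
    rw [e, hxpow, mul_assoc] at h
    exact le_of_mul_le_mul_left h hM
  -- By Bernoulli, `a` and `b` are the first-order losses in the square roots of the two factors of
  -- `h1`.
  set a := Y * (1 - q) with ha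
  set b := q * (1 - η) * (1 / k) with hb
  have hik : 0 < 1 / k := by positivity
  have hik1 : 1 / k ≤ 1 := by rw [div_le_one hk0]; exact hk1
  have ha0 : 0 ≤ a := mul_nonneg hY0 hq1.le
  have hb0 : 0 ≤ b := mul_nonneg (mul_nonneg hq0.le (by linarith)) hik.le
  have hYk : Y ≤ 1 / k := by rw [le_div_iff₀ hk0]; linarith
  have hab : a + b ≤ 1 / k := by
    have h2 : a ≤ 1 / k * (1 - q) := mul_le_mul_of_nonneg_right hYk hq1.le
    have h3 : b ≤ q * 1 * (1 / k) := by
      rw [hb]; gcongr; linarith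
    linarith
  have h2 : (1 - 1 / k) ^ (2 * q * (1 - η)) ≤ (1 - b) ^ 2 := by
    have h := rpow_one_add_le_one_add_mul_self (s := -(1 / k)) (by linarith)
      (p := q * (1 - η)) (mul_nonneg hq0.le (by linarith))
      (mul_le_one₀ (by linarith) (by linarith) (by linarith))
    have e : 2 * q * (1 - η) = q * (1 - η) * 2 := by ring
    rw [e, Real.rpow_mul (by linarith), Real.rpow_two]
    refine pow_le_pow_left₀ (Real.rpow_nonneg (by linarith) _) ?_ 2
    rw [sub_eq_add_neg]
    linarith
  have h3 : (1 - Y) ^ (2 / p) ≤ (1 - a) ^ 2 := by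
    have h := rpow_one_add_le_one_add_mul_self (s := -Y) (by linarith)
      (p := 1 / p) (by positivity) (by rw [hpq]; linarith)
    have e : 2 / p = 1 / p * 2 := by ring
    rw [e, Real.rpow_mul (by linarith), Real.rpow_two]
    refine pow_le_pow_left₀ (Real.rpow_nonneg (by linarith) _) ?_ 2
    rw [sub_eq_add_neg]
    rw [hpq] at h ⊢
    linarith
  have h4 : 1 - 2 * Y ≤ (1 - b) ^ 2 * (1 - a) ^ 2 :=
    h1.trans (mul_le_mul h2 h3 (Real.rpow_nonneg (by linarith) _) (sq_nonneg _))
  have h5 : a + b - Y ≤ (1 / k) ^ 2 := add_sub_le_sq ha0 hb0 (by linarith) hab h4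
  set y := k * Y with hy
  -- Here a + b - Y equals q(1 - η - y)/k. Since y = 1 would mean that all entries are equal, this
  -- bounds the deviation from the uniform vector.
  have hy1 : 1 - y ≤ η + 1 / (q * k) := by
    have e1 : a + b - Y = q * (1 - η - y) / k := by
      rw [ha, hb, hy]; field_simp; ring
    rw [e1, div_le_iff₀ hk0] at h5
    have e2 : (1 / k) ^ 2 * k = 1 / k := by field_simp
    rw [e2] at h5
    have h6 : 1 - η - y ≤ 1 / k / q := by rw [le_div_iff₀ hq0]; linarith
    have e3 : 1 / k / q = 1 / (q * k) := by field_simp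
    linarith
  have hy0 : 0 ≤ y := by positivity
  -- the eigenvalue equation at `w`
  set d : ℝ := (G.degree w : ℝ) with hd
  have hd0 : 0 ≤ d := by positivity
  have hdk : d ≤ k := by
    rw [hd, hk]; exact_mod_cast (G.degree_lt_card_verts w).le
  have hnb := nbrSum_eq_sum_neighborFinset G x w
  -- Each of the k - d vertices outside the neighbourhood takes at least `Y` of the p-norm.
  have hNle : ∑ v ∈ G.neighborFinset w, x v ^ p ≤ 1 - (k - d) * Y := by
    have h6 := sum_add_sum_compl (G.neighborFinset w) fun v => x v ^ p
    have h7 := card_nsmul_le_sum (G.neighborFinset w)ᶜ (fun v => x v ^ p) Y fun v _ => hYle v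
    rw [nsmul_eq_mul, card_compl, SimpleGraph.card_neighborFinset_eq_degree,
      Nat.cast_sub (G.degree_lt_card_verts w).le, ← hk] at h7
    rw [hs] at h6
    linarith
  have hN0 : 0 ≤ ∑ v ∈ G.neighborFinset w, x v ^ p :=
    sum_nonneg fun v _ => Real.rpow_nonneg (hx v) _
  have hhold : ∑ v ∈ G.neighborFinset w, x v ≤ (1 - (k - d) * Y) ^ (1 / p) * d ^ q := by
    have h := Real.inner_le_Lp_mul_Lq_of_nonneg (G.neighborFinset w) (f := x)
      (g := fun _ => (1 : ℝ)) (Real.HolderConjugate.conjExponent hp) (fun v _ => hx v)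
      (fun _ _ => zero_le_one)
    simp only [mul_one, Real.one_rpow, sum_const, nsmul_eq_mul,
      SimpleGraph.card_neighborFinset_eq_degree] at h
    have hq' : 1 / p.conjExponent = q := by
      rw [hq]; unfold Real.conjExponent; field_simp
    rw [hq'] at h
    exact h.trans (mul_le_mul_of_nonneg_right (Real.rpow_le_rpow hN0 hNle (by positivity))
      (by positivity))
  have hmain : M * Y ^ q ≤ (1 - (k - d) * Y) ^ (1 / p) * d ^ q := by
    rw [← hpow]
    refine le_trans ?_ (hnb ▸ hhold)
    rw [heig]
    exact mul_le_mul_of_nonneg_left (Real.rpow_le_rpow (hx u) (hu w (mem_univ w)) (by linarith))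
      hM.le
  set D := d / k with hD
  have hD0 : 0 ≤ D := by positivity
  have hD1 : D ≤ 1 := by rw [hD, div_le_one hk0]; exact hdk
  have hkD : d = k * D := by rw [hD]; field_simp
  have e1 : 1 - (k - d) * Y = 1 - (1 - D) * y := by rw [hkD, hy]; ring
  have hpos1 : 0 ≤ 1 - (1 - D) * y :=
    sub_nonneg.2 (mul_le_one₀ (by linarith) hy0 hkY)
  have hdiv : φ * y ^ q ≤ (1 - (1 - D) * y) ^ (1 - q) * D ^ q := by
    rw [e1, hkD, Real.mul_rpow hk0.le hD0, hφ, hpq] at hmain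
    have e2 : φ * k ^ (2 * q) * Y ^ q = φ * y ^ q * k ^ q := by
      rw [hy, Real.mul_rpow hk0.le hY0, two_mul, Real.rpow_add hk0]; ring
    rw [e2] at hmain
    have hkq : 0 < k ^ q := by positivity
    refine le_of_mul_le_mul_right (hmain.trans (le_of_eq ?_)) hkq
    ring
  have hamgm := Real.geom_mean_le_arith_mean2_weighted hq1.le hq0.le hpos1 hD0 (by ring)
  have hyq : y ≤ y ^ q := Real.self_le_rpow_of_le_one hy0 hkY (by linarith)
  have hfin : φ * y ≤ D + (1 - y) := by
    have h6 := mul_le_mul_of_nonneg_left hyq hφ0.le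
    have h7 : (1 - q) * (1 - (1 - D) * y) + q * D ≤ D + (1 - y) := by
      have : 0 ≤ (1 - q) * (D * (1 - y)) := mul_nonneg hq1.le (mul_nonneg hD0 (by linarith))
      have : 0 ≤ q * (1 - y) := mul_nonneg hq0.le (by linarith)
      linarith
    linarith
  have hφ1 : φ ≤ 1 := by
    have h := pSpectralRadius_le_card_rpow hp G
    rw [← hMdef, hφ, ← hk, ← hq] at h
    have : 0 < k ^ (2 * q) := by positivity
    exact le_of_mul_le_mul_right (by linarith) this
  have h8 : φ * (1 - y) ≤ 1 * (1 - y) := mul_le_mul_of_nonneg_right hφ1 (by linarith)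
  rw [hkD, mul_comm k D]
  refine mul_le_mul_of_nonneg_right ?_ hk0.le
  linarith

end MinDegree

/-! ### Induced subgraphs and extension of vectors by zero. -/

section Induced

variable {V : Type*} [Fintype V]

theorem quadForm_induce (G : SimpleGraph V) (S : Finset V) {y : V → ℝ} (hy : ∀ v, v ∉ S → y v = 0) :
    quadForm (G.induce (S : Set V)) (fun v => y v) = quadForm G y := by
  classical
  rw [quadForm_eq_sum, quadForm_eq_sum]
  have h1 : ∀ f : V → ℝ, (∀ v, v ∉ S → f v = 0) → ∑ v : (S : Set V), f v = ∑ v, f v := by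
    intro f hf
    rw [← sum_subset (subset_univ S) fun v _ hv => hf v hv]
    exact sum_coe_sort S f
  rw [← h1]
  · refine sum_congr rfl fun u _ => ?_
    rw [← h1]
    · rfl
    · intro v hv; simp [hy v hv]
  · intro u hu; simp [hy u hu]

theorem sum_rpow_induce {p : ℝ} (hp : 0 < p) (S : Finset V) {y : V → ℝ}
    (hy : ∀ v, v ∉ S → y v = 0) :
    ∑ v : (S : Set V), |y v| ^ p = ∑ v, |y v| ^ p := by
  rw [← sum_subset (subset_univ S) fun v _ hv => by
    rw [hy v hv, abs_zero, Real.zero_rpow hp.ne']]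
  exact sum_coe_sort S fun v => |y v| ^ p

theorem quadForm_le_pSpectralRadius_induce {p : ℝ} (hp : 1 ≤ p) (G : SimpleGraph V) {S : Finset V}
    (hS : S.Nonempty) {y : V → ℝ} (hy : ∀ v, v ∉ S → y v = 0) :
    quadForm G y ≤ pSpectralRadius p (G.induce (S : Set V)) * (∑ v, |y v| ^ p) ^ (2 / p) := by
  have : Nonempty (S : Set V) := hS.coe_sort
  have h := quadForm_le_pSpectralRadius hp (G.induce (S : Set V)) fun v => y v
  rwa [quadForm_induce G S hy, sum_rpow_induce (by linarith) S hy] at h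

theorem quadForm_induce_le_of_erase [DecidableEq V] {p : ℝ} (hp : 1 ≤ p) (G : SimpleGraph V)
    {S : Finset V} (u : (S : Set V)) (hS : (S.erase u).Nonempty) {y : ↥(S : Set V) → ℝ}
    (hy : y u = 0) :
    quadForm (G.induce (S : Set V)) y ≤
      pSpectralRadius p (G.induce ((S.erase u : Finset V) : Set V)) *
        (∑ v, |y v| ^ p) ^ (2 / p) := by
  have hp0 : 0 < p := by linarith
  let z : V → ℝ := fun v => if h : v ∈ S then y ⟨v, h⟩ else 0
  have hz : ∀ v : (S : Set V), z v = y v := fun v => by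
    have : (v : V) ∈ S := v.2
    simp [z, this]
  have hzS : ∀ v, v ∉ S → z v = 0 := fun v hv => by simp [z, hv]
  have hze : ∀ v, v ∉ S.erase u → z v = 0 := by
    intro v hv
    by_cases h : v ∈ S
    · have : v = u := by
        by_contra hne
        exact hv (mem_erase.2 ⟨hne, h⟩)
      subst this
      rw [hz, hy]
    · exact hzS v h
  have h := quadForm_le_pSpectralRadius_induce hp G hS hze
  rw [← quadForm_induce G S hzS, ← sum_rpow_induce hp0 S hzS] at h
  simpa only [hz] using h

theorem pSpectralRadius_induce_univ (p : ℝ) (G : SimpleGraph V) :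
    pSpectralRadius p (G.induce ((univ : Finset V) : Set V)) = pSpectralRadius p G := by
  refine pSpectralRadius_iso ⟨Equiv.subtypeUnivEquiv (by simp), fun {a b} => ?_⟩ p
  simp

end Induced

/-! ### The critical induced subgraph. -/

section Critical

variable {V : Type*} [Fintype V]

/-- A vertex set that maximizes `λ^(p)(G[S]) / |S|^α` loses at least a factor `(1 - 1/|S|)^α` when
a vertex is deleted. -/
theorem exists_critical_induce [Nonempty V] {p : ℝ} (hp : 1 ≤ p) (G : SimpleGraph V) (α : ℝ) :
    ∃ S : Finset V, S.Nonempty ∧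
      pSpectralRadius p G * (#S : ℝ) ^ α ≤
        pSpectralRadius p (G.induce (S : Set V)) * (Fintype.card V : ℝ) ^ α ∧
      (2 ≤ #S → ∀ (u : ↥(S : Set V)) (y : ↥(S : Set V) → ℝ), y u = 0 →
        quadForm (G.induce (S : Set V)) y ≤ pSpectralRadius p (G.induce (S : Set V)) *
          (1 - 1 / (#S : ℝ)) ^ α * (∑ v, |y v| ^ p) ^ (2 / p)) := by
  classical
  obtain ⟨S, hS, hmax⟩ := exists_max_image (univ.filter fun S : Finset V => S.Nonempty)
    (fun S => pSpectralRadius p (G.induce (S : Set V)) / (#S : ℝ) ^ α) ⟨univ, by simp⟩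
  have hS := (mem_filter.1 hS).2
  have hS0 : (0 : ℝ) < #S := by exact_mod_cast hS.card_pos
  refine ⟨S, hS, ?_, fun h2 u y hy => ?_⟩
  · have h := hmax univ (by simp)
    rw [pSpectralRadius_induce_univ, card_univ, div_le_div_iff₀ (by positivity) (by positivity)] at h
    exact h
  · have hcard : #(S.erase u) = #S - 1 := card_erase_of_mem u.2
    have hne : (S.erase u).Nonempty := card_pos.1 (by lia)
    refine (quadForm_induce_le_of_erase hp G u hne hy).trans ?_
    refine mul_le_mul_of_nonneg_right ?_
      (Real.rpow_nonneg (sum_nonneg fun v _ => Real.rpow_nonneg (abs_nonneg _) _) _)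
    have h := hmax (S.erase u) (by simp [hne])
    have hc : ((#(S.erase u) : ℕ) : ℝ) = #S * (1 - 1 / #S) := by
      rw [hcard, Nat.cast_sub (by lia)]; field_simp; simp
    have hc0 : (0 : ℝ) ≤ 1 - 1 / #S := by
      rw [sub_nonneg, div_le_one hS0]; exact_mod_cast (by lia : 1 ≤ #S)
    have he0 : (0 : ℝ) < #(S.erase u) := by exact_mod_cast hne.card_pos
    rw [div_le_div_iff₀ (by positivity) (by positivity), hc, Real.mul_rpow hS0.le hc0] at h
    have hSα : (0 : ℝ) < (#S : ℝ) ^ α := by positivity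
    refine le_of_mul_le_mul_right (h.trans (le_of_eq ?_)) hSα
    ring

end Critical

/-! ### Numerical estimates for the choice η = 1/(4r^4). -/

section Estimates

theorem exponent_le {r : ℝ} (hr : 2 ≤ r) : (r - 1) * (5 / 2 * r ^ 4 + 12) ≤ r ^ 6 := by
  obtain ⟨t, ht, rfl⟩ : ∃ t : ℝ, 0 ≤ t ∧ r = 2 + t := ⟨r - 2, by linarith, by ring⟩
  have h2 := pow_nonneg ht 2
  have h3 := pow_nonneg ht 3
  have h4 := pow_nonneg ht 4
  have h5 := pow_nonneg ht 5
  have h6 := pow_nonneg ht 6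
  ring_nf
  linarith

/-- The hypothesis of `le_jointSize_of_minDegree` for β = 1/r + 5/(8r^4) and δ = 1/r^4. -/
theorem joint_condition {r : ℝ} (hr : 2 ≤ r) :
    r * (r + 1) * ((r - 2) * (1 / r + 5 / (8 * r ^ 4)) + 1 / r ^ 4) ≤
      2 * (r - 1) * (r + 1) * (1 - (1 / r + 5 / (8 * r ^ 4))) - r * (r - 1) := by
  have hr0 : 0 < r := by linarith
  have e : 2 * (r - 1) * (r + 1) * (1 - (1 / r + 5 / (8 * r ^ 4))) - r * (r - 1) -
      r * (r + 1) * ((r - 2) * (1 / r + 5 / (8 * r ^ 4)) + 1 / r ^ 4) =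
      (16 * r ^ 3 - (r + 1) * (5 * r ^ 2 - 10) - 8 * r * (r + 1)) / (8 * r ^ 4) := by
    field_simp
    ring
  rw [← sub_nonneg, e]
  refine div_nonneg ?_ (by positivity)
  obtain ⟨t, ht, rfl⟩ : ∃ t : ℝ, 0 ≤ t ∧ r = 2 + t := ⟨r - 2, by linarith, by ring⟩
  have h2 := pow_nonneg ht 2
  have h3 := pow_nonneg ht 3
  ring_nf
  linarith

theorem two_pow_le_pow {r : ℝ} (hr : 2 ≤ r) (m : ℕ) : (2 : ℝ) ^ m ≤ r ^ m :=
  pow_le_pow_left₀ (by norm_num) hr m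

theorem pow_div_le_rpow {r q : ℝ} (hr : 2 ≤ r) (hq0 : 0 < q) (hq1 : q ≤ 1) :
    r ^ 11 / q ≤ r ^ (12 / q) := by
  have h12 : 1 ≤ r ^ 12 := one_le_pow₀ (by linarith)
  have h := one_add_mul_self_le_rpow_one_add (s := r ^ 12 - 1) (by linarith)
    (p := 1 / q) (by rw [le_div_iff₀ hq0]; linarith)
  have e : r ^ (12 / q) = (1 + (r ^ 12 - 1)) ^ (1 / q) := by
    rw [add_sub_cancel, ← Real.rpow_natCast, ← Real.rpow_mul (by linarith)]
    congr 1; push_cast; ring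
  rw [e]
  refine le_trans ?_ h
  have h11 : (1 : ℝ) ≤ r ^ 11 := one_le_pow₀ (by linarith)
  have h2 : r ^ 11 ≤ r ^ 12 - 1 := by
    have : r ^ 12 = r * r ^ 11 := by ring
    nlinarith
  have h3 : 1 / q * r ^ 11 ≤ 1 / q * (r ^ 12 - 1) := mul_le_mul_of_nonneg_left h2 (by positivity)
  have h4 : r ^ 11 / q = 1 / q * r ^ 11 := by ring
  linarith

/-- The case r = 2 is critical: there r - 1 = 1, and the extra factor r^(1/4) ≥ 59/50 gained from
the exponent 5/4 absorbs the rounding term. -/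
theorem rpow_neg_le_density {r n : ℝ} (hr : 2 ≤ r) (hn : r ^ 11 ≤ n) :
    r ^ (-(5 / 4) : ℝ) ≤ 1 - 1 / r - r / n ^ 2 := by
  have hr0 : 0 < r := by linarith
  have h1 : (59 / 50 : ℝ) ≤ r ^ (1 / 4 : ℝ) := by
    refine le_trans ?_ (Real.rpow_le_rpow (by norm_num) hr (by norm_num))
    rw [Real.le_rpow_iff_log_le (by norm_num) (by norm_num)]
    have : Real.log ((59 / 50 : ℝ) ^ 4) ≤ Real.log 2 :=
      Real.log_le_log (by norm_num) (by norm_num)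
    rw [Real.log_pow] at this
    push_cast at this
    linarith
  have h2 : r ^ (5 / 4 : ℝ) = r * r ^ (1 / 4 : ℝ) := by
    nth_rewrite 2 [← Real.rpow_one r]
    rw [← Real.rpow_add hr0]; norm_num
  have h4 : r ^ 2 / n ^ 2 ≤ 1 / 100 := by
    have h5 : (r ^ 11) ^ 2 ≤ n ^ 2 := pow_le_pow_left₀ (by positivity) hn 2
    have h6 : 0 < n ^ 2 := lt_of_lt_of_le (by positivity) h5
    rw [div_le_iff₀ h6]
    have h7 := two_pow_le_pow hr 20
    have h8 : (r ^ 11) ^ 2 = r ^ 20 * r ^ 2 := by ring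
    have h9 := mul_le_mul_of_nonneg_right h7 (sq_nonneg r)
    have := sq_nonneg r
    linarith
  have e : 1 - 1 / r - r / n ^ 2 = (r - 1 - r ^ 2 / n ^ 2) / r := by field_simp
  rw [Real.rpow_neg hr0.le, e, h2, inv_le_iff_one_le_mul₀ (by positivity)]
  have h10 : (r - 1 - r ^ 2 / n ^ 2) / r * (r * r ^ (1 / 4 : ℝ)) =
      (r - 1 - r ^ 2 / n ^ 2) * r ^ (1 / 4 : ℝ) := by field_simp
  rw [h10]
  have h11 : (99 / 100 : ℝ) * (59 / 50) ≤ (r - 1 - r ^ 2 / n ^ 2) * r ^ (1 / 4 : ℝ) :=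
    mul_le_mul (by linarith) h1 (by norm_num) (by linarith)
  linarith

theorem le_of_rpow_mul_le {r n k q η : ℝ} (hr : 2 ≤ r) (hn : 0 < n) (hk : 0 < k) (hq : 0 < q)
    (hη : η = 1 / (4 * r ^ 4)) (h : r ^ (-(5 / 4) : ℝ) * n ^ (2 * q * η) ≤ k ^ (2 * q * η)) :
    n * r ^ (-(5 / 2 * r ^ 4 / q)) ≤ k := by
  have hr0 : 0 < r := by linarith
  have hη0 : 0 < η := by rw [hη]; positivity
  have hpos : 0 < 2 * q * η := by positivity
  have e : r ^ (-(5 / 4) : ℝ) * n ^ (2 * q * η) =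
      (n * r ^ (-(5 / 2 * r ^ 4 / q))) ^ (2 * q * η) := by
    rw [Real.mul_rpow hn.le (by positivity), ← Real.rpow_mul hr0.le, mul_comm]
    congr 2
    rw [hη]; field_simp
  rw [e] at h
  exact (Real.rpow_le_rpow_iff (by positivity) hk.le hpos).1 h

/-- With (r - 1)! ≤ r^(r - 1), the powers of r lost are r - 1 times 5 + (5/2)r^4/q, which is below
r^6/q by `exponent_le`. -/
theorem div_rpow_lt_joint_bound {r : ℕ} {n k q : ℝ} (hr : 2 ≤ r) (hn : 0 < n) (hq0 : 0 < q)
    (hq1 : q ≤ 1) (h : n * (r : ℝ) ^ (-(5 / 2 * (r : ℝ) ^ 4 / q)) ≤ k) :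
    n ^ (r - 1) / (r : ℝ) ^ ((r : ℝ) ^ 6 / q) <
      (1 / (r : ℝ) ^ 4 * k) ^ (r - 1) / (r - 1).factorial := by
  have hrR : (2 : ℝ) ≤ r := by exact_mod_cast hr
  have hr0 : (0 : ℝ) < r := by linarith
  have hfac : ((r - 1).factorial : ℝ) ≤ (r : ℝ) ^ (r - 1) := by
    have h1 := Nat.factorial_le_pow (r - 1)
    have h2 : (r - 1) ^ (r - 1) ≤ r ^ (r - 1) := Nat.pow_le_pow_left (by lia) _
    exact_mod_cast h1.trans h2
  have hcast : ((r - 1 : ℕ) : ℝ) = (r : ℝ) - 1 := by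
    rw [Nat.cast_sub (by lia)]; simp
  rw [lt_div_iff₀ (by positivity)]
  have h1 : n ^ (r - 1) / (r : ℝ) ^ ((r : ℝ) ^ 6 / q) * (r - 1).factorial ≤
      n ^ (r - 1) / (r : ℝ) ^ ((r : ℝ) ^ 6 / q) * (r : ℝ) ^ (r - 1) :=
    mul_le_mul_of_nonneg_left hfac (by positivity)
  have h2 : (1 / (r : ℝ) ^ 4 * (n * (r : ℝ) ^ (-(5 / 2 * (r : ℝ) ^ 4 / q)))) ^ (r - 1) ≤
      (1 / (r : ℝ) ^ 4 * k) ^ (r - 1) :=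
    pow_le_pow_left₀ (by positivity) (mul_le_mul_of_nonneg_left h (by positivity)) _
  refine h1.trans_lt (lt_of_lt_of_le ?_ h2)
  have e1 : n ^ (r - 1) / (r : ℝ) ^ ((r : ℝ) ^ 6 / q) * (r : ℝ) ^ (r - 1) =
      n ^ (r - 1) * (r : ℝ) ^ ((r : ℝ) - 1 - (r : ℝ) ^ 6 / q) := by
    rw [Real.rpow_sub hr0, ← hcast, Real.rpow_natCast]; ring
  have e2 : (1 / (r : ℝ) ^ 4 * (n * (r : ℝ) ^ (-(5 / 2 * (r : ℝ) ^ 4 / q)))) ^ (r - 1) =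
      n ^ (r - 1) * (r : ℝ) ^ ((-4 - 5 / 2 * (r : ℝ) ^ 4 / q) * ((r : ℝ) - 1)) := by
    have e3 : 1 / (r : ℝ) ^ 4 * (n * (r : ℝ) ^ (-(5 / 2 * (r : ℝ) ^ 4 / q))) =
        n * (r : ℝ) ^ (-4 - 5 / 2 * (r : ℝ) ^ 4 / q) := by
      rw [sub_eq_add_neg, Real.rpow_add hr0, Real.rpow_neg hr0.le 4]
      norm_cast
      ring
    rw [e3, mul_pow, ← hcast, Real.rpow_mul hr0.le, Real.rpow_natCast]
  rw [e1, e2]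
  refine mul_lt_mul_of_pos_left (Real.rpow_lt_rpow_of_exponent_lt (by linarith) ?_) (by positivity)
  have h3 := exponent_le hrR
  have h4 : ((r : ℝ) - 1) * (5 / 2 * (r : ℝ) ^ 4 + 12) / q ≤ (r : ℝ) ^ 6 / q :=
    div_le_div_of_nonneg_right h3 hq0.le
  have e4 : ((r : ℝ) - 1) * (5 / 2 * (r : ℝ) ^ 4 + 12) / q =
      ((r : ℝ) - 1) * (5 / 2 * (r : ℝ) ^ 4 / q) + ((r : ℝ) - 1) * (12 / q) := by ring
  have h5 : (12 : ℝ) ≤ 12 / q := by rw [le_div_iff₀ hq0]; linarith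
  have h6 : ((r : ℝ) - 1) * 12 ≤ ((r : ℝ) - 1) * (12 / q) :=
    mul_le_mul_of_nonneg_left h5 (by linarith)
  linarith

theorem rpow_le_of_rpow_le_pow {r : ℕ} {n q : ℝ} (hr : 2 ≤ r) (hn : 0 ≤ n) (hq0 : 0 < q)
    (h : (r : ℝ) ^ ((r : ℝ) ^ 6 / q) ≤ n ^ (r - 1)) :
    (r : ℝ) ^ ((5 / 2 * (r : ℝ) ^ 4 + 12) / q) ≤ n := by
  have hrR : (2 : ℝ) ≤ r := by exact_mod_cast hr
  have hr0 : (0 : ℝ) < r := by linarith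
  have hcast : ((r - 1 : ℕ) : ℝ) = (r : ℝ) - 1 := by
    rw [Nat.cast_sub (by lia)]; simp
  refine le_of_pow_le_pow_left₀ (n := r - 1) (by lia) hn (le_trans ?_ h)
  rw [← Real.rpow_natCast, ← Real.rpow_mul hr0.le, hcast]
  refine Real.rpow_le_rpow_of_exponent_le (by linarith) ?_
  rw [div_mul_eq_mul_div]
  refine div_le_div_of_nonneg_right ?_ hq0.le
  have := exponent_le hrR
  linarith

/-- The gain from passing to a proper subset outweighs the rounding error in the Turán graph. -/
theorem density_lt_of_card_lt {r n k q η φ : ℝ} (hr : 2 ≤ r) (hq0 : 0 < q) (hq1 : q ≤ 1)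
    (hη : η = 1 / (4 * r ^ 4)) (hk0 : 0 < k) (hkn : k ≤ n - 1) (hn : r ^ 11 / q ≤ n)
    (h : (1 - 1 / r - r / n ^ 2) * n ^ (2 * q * η) ≤ φ * k ^ (2 * q * η)) : 1 - 1 / r < φ := by
  by_contra! hφ
  have hr0 : 0 < r := by linarith
  have hn0 : 0 < n := by linarith
  have h16 := two_pow_le_pow hr 4
  have hη0 : 0 < η := by rw [hη]; positivity
  have hη1 : η ≤ 1 / 2 := by
    rw [hη, div_le_div_iff₀ (by positivity) (by norm_num)]; linarith
  have hb := rpow_one_add_le_one_add_mul_self (s := -(1 / n))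
    (by rw [neg_le_neg_iff, div_le_one hn0]; linarith) (p := 2 * q * η) (by positivity)
    (by have := mul_le_mul hq1 hη1 hη0.le zero_le_one; linarith)
  have hkn' : k ≤ n * (1 + -(1 / n)) := by
    have : n * (1 + -(1 / n)) = n - 1 := by field_simp; ring
    linarith
  have h1n : 0 ≤ 1 + -(1 / n) := by
    by_contra! hc
    have := mul_neg_of_pos_of_neg hn0 hc
    linarith
  have h1 : k ^ (2 * q * η) ≤ n ^ (2 * q * η) * (1 + 2 * q * η * -(1 / n)) := by
    refine (Real.rpow_le_rpow hk0.le hkn' (by positivity)).trans ?_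
    rw [Real.mul_rpow hn0.le h1n]
    exact mul_le_mul_of_nonneg_left hb (by positivity)
  have hir : 1 / r ≤ 1 / 2 := one_div_le_one_div_of_le (by norm_num) hr
  have h2 : φ * k ^ (2 * q * η) ≤ (1 - 1 / r) * (n ^ (2 * q * η) * (1 + 2 * q * η * -(1 / n))) :=
    mul_le_mul hφ h1 (by positivity) (by linarith)
  have hpos : 0 < n ^ (2 * q * η) := by positivity
  have h3 : 1 - 1 / r - r / n ^ 2 ≤ (1 - 1 / r) * (1 + 2 * q * η * -(1 / n)) := by
    refine le_of_mul_le_mul_right ?_ hpos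
    linarith
  have h4 : (1 - 1 / r) * (2 * q * η) * (1 / n) ≤ r / n ^ 2 := by linarith
  have h5 : 1 / 2 * (2 * q * η) * (1 / n) ≤ (1 - 1 / r) * (2 * q * η) * (1 / n) := by
    gcongr; linarith
  -- A gain of order qη/n would have to be at most the rounding loss r/n², whereas n ≥ r^11/q makes
  -- qηn at least r^7/4.
  have h6 : q * η * n ≤ r := by
    have h7 := mul_le_mul_of_nonneg_right (h5.trans h4) (sq_nonneg n)
    have e1 : r / n ^ 2 * n ^ 2 = r := by field_simp
    have e2 : 1 / 2 * (2 * q * η) * (1 / n) * n ^ 2 = q * η * n := by field_simp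
    linarith
  have h8 : q * η * (r ^ 11 / q) ≤ r :=
    (mul_le_mul_of_nonneg_left hn (by positivity)).trans h6
  have e3 : q * η * (r ^ 11 / q) = r * (r ^ 6 / 4) := by rw [hη]; field_simp
  have h9 := two_pow_le_pow hr 6
  have h10 : r * 2 ≤ r * (r ^ 6 / 4) := mul_le_mul_of_nonneg_left (by linarith) hr0.le
  linarith

end Estimates

/-! ### Assembly of the proof. -/

theorem lt_jointSize_of_large {V : Type*} [Fintype V] [Nonempty V] (G : SimpleGraph V) {r : ℕ}
    {p q : ℝ} (hr : 2 ≤ r) (hp : 1 < p) (hq : q = 1 - 1 / p)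
    (hG : pSpectralRadius p (SimpleGraph.turanGraph (Fintype.card V) r) ≤ pSpectralRadius p G)
    (hcl : ¬ G.CliqueFree (r + 1))
    (hlarge : (r : ℝ) ^ ((r : ℝ) ^ 6 / q) ≤ (Fintype.card V : ℝ) ^ (r - 1)) :
    (Fintype.card V : ℝ) ^ (r - 1) / (r : ℝ) ^ ((r : ℝ) ^ 6 / q) < jointSize G (r + 1) := by
  classical
  have hrR : (2 : ℝ) ≤ r := by exact_mod_cast hr
  have hr0 : (0 : ℝ) < r := by linarith
  have hp0 : 0 < p := by linarith
  have hq0 : 0 < q := by rw [hq, sub_pos, div_lt_one hp0]; exact hp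
  have hq1 : q ≤ 1 := by
    have : 0 < 1 / p := by positivity
    linarith
  set n : ℝ := (Fintype.card V : ℝ) with hn
  have hn0 : 0 < n := by rw [hn]; exact_mod_cast Fintype.card_pos
  clear_value n
  have hnlow := rpow_le_of_rpow_le_pow hr hn0.le hq0 hlarge
  have h11 := pow_div_le_rpow hrR hq0 hq1
  have h11q : (r : ℝ) ^ 11 ≤ (r : ℝ) ^ 11 / q := le_div_self (by positivity) hq0 hq1
  have hn11 : (r : ℝ) ^ 11 / q ≤ n := by
    refine h11.trans (le_trans ?_ hnlow)
    refine Real.rpow_le_rpow_of_exponent_le (by linarith) ?_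
    refine div_le_div_of_nonneg_right ?_ hq0.le
    have : (0 : ℝ) ≤ 5 / 2 * (r : ℝ) ^ 4 := by positivity
    linarith
  have h2048 := two_pow_le_pow hrR 11
  have hn2 : 2 ≤ Fintype.card V := by
    have : (2 : ℝ) ≤ Fintype.card V := by rw [← hn]; linarith
    exact_mod_cast this
  set η : ℝ := 1 / (4 * (r : ℝ) ^ 4) with hη
  have hη0 : 0 < η := by positivity
  have hη1 : η ≤ 1 := by
    rw [hη, div_le_one (by positivity)]
    have := two_pow_le_pow hrR 4
    linarith
  obtain ⟨S, hS, hratio, hcrit⟩ := exists_critical_induce hp.le G (2 * q * (1 - η))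
  rw [← hn] at hratio
  have hSne : Nonempty ↥(S : Set V) := hS.coe_sort
  set k : ℝ := (#S : ℝ) with hk
  have hk0 : 0 < k := by rw [hk]; exact_mod_cast hS.card_pos
  have hkn : k ≤ n := by rw [hk, hn]; exact_mod_cast card_le_univ S
  have hkcard : k = Fintype.card ↥(S : Set V) := by
    rw [hk]; congr 1; exact (Fintype.card_coe S).symm
  clear_value k
  set φ : ℝ := pSpectralRadius p (G.induce (S : Set V)) / k ^ (2 * q) with hφ
  have hφeq : pSpectralRadius p (G.induce (S : Set V)) = φ * k ^ (2 * q) := by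
    rw [hφ]; field_simp
  have hφ1 : φ ≤ 1 := by
    rw [hφ, div_le_one (by positivity), hkcard, hq]
    exact pSpectralRadius_le_card_rpow hp _
  have hT := (le_pSpectralRadius_turanGraph hp hr hn2).trans hG
  rw [← hq, ← hn] at hT
  set φ₀ : ℝ := 1 - 1 / r - r / n ^ 2 with hφ₀
  -- passing to `S` does not decrease the normalized spectral radius
  have hgrow : φ₀ * n ^ (2 * q * η) ≤ φ * k ^ (2 * q * η) := by
    have h1 := (mul_le_mul_of_nonneg_right hT
      (show 0 ≤ k ^ (2 * q * (1 - η)) by positivity)).trans hratio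
    rw [hφeq] at h1
    have e : ∀ z : ℝ, 0 < z → z ^ (2 * q) = z ^ (2 * q * η) * z ^ (2 * q * (1 - η)) := by
      intro z hz
      rw [← Real.rpow_add hz]; ring_nf
    rw [e n hn0, e k hk0] at h1
    have hpos : 0 < k ^ (2 * q * (1 - η)) * n ^ (2 * q * (1 - η)) := by positivity
    refine le_of_mul_le_mul_right ?_ hpos
    linarith
  have hdens := rpow_neg_le_density hrR (h11q.trans hn11)
  rw [← hφ₀] at hdens
  -- Since φ ≤ 1, `hgrow` bounds (k/n)^(2qη) below by φ₀ ≥ r^(-5/4); taking roots gives the exponent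
  -- (5/4)·4r^4/(2q).
  have hklow : n * (r : ℝ) ^ (-(5 / 2 * (r : ℝ) ^ 4 / q)) ≤ k := by
    refine le_of_rpow_mul_le hrR hn0 hk0 hq0 hη ?_
    have h1 : (r : ℝ) ^ (-(5 / 4) : ℝ) * n ^ (2 * q * η) ≤ φ₀ * n ^ (2 * q * η) :=
      mul_le_mul_of_nonneg_right hdens (by positivity)
    have h2 : φ * k ^ (2 * q * η) ≤ 1 * k ^ (2 * q * η) :=
      mul_le_mul_of_nonneg_right hφ1 (by positivity)
    linarith
  have hk11 : (r : ℝ) ^ 11 / q ≤ k := by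
    refine h11.trans (le_trans ?_ hklow)
    have h1 := mul_le_mul_of_nonneg_right hnlow
      (show 0 ≤ (r : ℝ) ^ (-(5 / 2 * (r : ℝ) ^ 4 / q)) by positivity)
    rw [← Real.rpow_add hr0] at h1
    refine le_trans (le_of_eq ?_) h1
    congr 1; ring
  have hφ₀pos : 0 < φ₀ := lt_of_lt_of_le (by positivity) hdens
  have hφge : φ₀ ≤ φ := by
    have h1 : φ₀ * k ^ (2 * q * η) ≤ φ₀ * n ^ (2 * q * η) :=
      mul_le_mul_of_nonneg_left (Real.rpow_le_rpow hk0.le hkn (by positivity)) hφ₀pos.le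
    have hpos : 0 < k ^ (2 * q * η) := by positivity
    exact le_of_mul_le_mul_right (h1.trans hgrow) hpos
  have hk2 : 2 ≤ #S := by
    have : (2 : ℝ) ≤ #S := by rw [← hk]; linarith
    exact_mod_cast this
  have hdeg := le_degree_of_forall_deletion (G.induce (S : Set V)) hp hq hη0.le hη1 hkcard
    (by linarith) (hφ₀pos.trans_le hφge) hφeq (hcrit hk2)
  have hcl' : ¬ (G.induce (S : Set V)).CliqueFree (r + 1) := by
    intro hfree
    rcases eq_or_ne S univ with hSu | hSu
    · subst hSu
      refine hcl (hfree.comap ⟨⟨⟨fun v => ⟨v, by simp⟩, ?_⟩, ?_⟩⟩)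
      · intro a b hab; exact hab
      · intro a b hab; exact congrArg Subtype.val hab
    · have hlt : #S < Fintype.card V := (card_lt_iff_ne_univ S).2 hSu
      have hkn1 : k ≤ n - 1 := by
        rw [hk, hn, le_sub_iff_add_le]; exact_mod_cast hlt
      have h1 := density_lt_of_card_lt hrR hq0 hq1 hη hk0 hkn1 hn11 hgrow
      have h2 := pSpectralRadius_le_of_cliqueFree hp hr hfree
      rw [hφeq, ← hkcard, ← hq] at h2
      exact absurd (le_of_mul_le_mul_right h2 (by positivity)) (not_le.2 h1)
  have hr4 : (0 : ℝ) < (r : ℝ) ^ 4 := by positivity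
  -- Of 5/(8r^4) = 5η/2, the degree bound takes 2η. The remaining η/2 covers 2/(qk) and r/n²,
  -- together at most 3/r^11.
  have hmin : ∀ v, (1 - (1 / (r : ℝ) + 5 / (8 * (r : ℝ) ^ 4))) * k ≤
      (G.induce (S : Set V)).degree v := by
    intro v
    refine le_trans (mul_le_mul_of_nonneg_right ?_ hk0.le) (hdeg v)
    have h1 : 1 / (q * k) ≤ 1 / (r : ℝ) ^ 11 := by
      refine one_div_le_one_div_of_le (by positivity) ?_
      rw [div_le_iff₀ hq0] at hk11
      linarith
    have h2 : (r : ℝ) / n ^ 2 ≤ 1 / (r : ℝ) ^ 11 := by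
      have hnr := h11q.trans hn11
      rw [div_le_div_iff₀ (by positivity) (by positivity), one_mul, sq]
      have h3 : (r : ℝ) ≤ n := by
        refine le_trans ?_ hnr
        exact le_self_pow₀ (by linarith) (by norm_num)
      exact mul_le_mul h3 hnr (by positivity) hn0.le
    have h3 : 1 / (r : ℝ) ^ 11 ≤ 1 / (24 * (r : ℝ) ^ 4) := by
      refine one_div_le_one_div_of_le (by positivity) ?_
      have h4 := two_pow_le_pow hrR 7
      have h5 := mul_le_mul_of_nonneg_right h4 hr4.le
      have e : (r : ℝ) ^ 11 = (r : ℝ) ^ 7 * (r : ℝ) ^ 4 := by ring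
      rw [e]
      linarith
    have e1 : 1 / (24 * (r : ℝ) ^ 4) = η / 6 := by rw [hη]; field_simp; norm_num
    have e2 : 5 / (8 * (r : ℝ) ^ 4) = 5 / 2 * η := by rw [hη]; field_simp; norm_num
    rw [e1] at h3
    rw [e2]
    linarith
  have hjoint := le_jointSize_of_minDegree (G.induce (S : Set V)) hr hkcard (by positivity)
    (show (0 : ℝ) ≤ 1 / (r : ℝ) ^ 4 by positivity) hmin hcl' (joint_condition hrR)
  refine (div_rpow_lt_joint_bound hr hn0 hq0 hq1 hklow).trans_le (hjoint.trans ?_)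
  exact_mod_cast jointSize_le_of_embedding (SimpleGraph.Embedding.induce (S : Set V)) (r + 1)

end PSpectral

theorem theorem5 {V : Type*} [Fintype V] (G : SimpleGraph V) (n r : ℕ) (p : ℝ)
    (hr : 2 ≤ r) (hp : 1 < p) (hn : Fintype.card V = n)
    (hG : PSpectral.pSpectralRadius p (SimpleGraph.turanGraph n r) ≤
      PSpectral.pSpectralRadius p G)
    (hne : ¬ Nonempty (G ≃g SimpleGraph.turanGraph n r)) :
    (n : ℝ) ^ (r - 1) / (r : ℝ) ^ ((r : ℝ) ^ 6 * p / (p - 1)) <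
      (PSpectral.jointSize G (r + 1) : ℝ) := by
  subst hn
  have hr0 : (0 : ℝ) < r := by exact_mod_cast (by lia : 0 < r)
  rcases isEmpty_or_nonempty V with hV | hV
  · exact absurd ⟨⟨Fintype.equivFin V, fun {a} => hV.elim a⟩⟩ hne
  have hcl : ¬ G.CliqueFree (r + 1) := fun h =>
    hne (PSpectral.nonempty_iso_turanGraph_of_le hp hr h hG)
  have hexp : (r : ℝ) ^ 6 * p / (p - 1) = (r : ℝ) ^ 6 / (1 - 1 / p) := by
    have h1 : p ≠ 0 := by linarith
    have h2 : p - 1 ≠ 0 := by linarith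
    have h3 : 1 - 1 / p = (p - 1) / p := by field_simp
    rw [h3, div_div_eq_mul_div]
  rw [hexp]
  -- For small n the claimed bound is below 1, and one (r+1)-clique is enough.
  rcases lt_or_ge ((Fintype.card V : ℝ) ^ (r - 1)) ((r : ℝ) ^ ((r : ℝ) ^ 6 / (1 - 1 / p)))
    with hlt | hge
  · have h1 : (1 : ℝ) ≤ PSpectral.jointSize G (r + 1) := by
      exact_mod_cast PSpectral.jointSize_pos (by lia) hcl
    refine lt_of_lt_of_le ?_ h1
    rwa [div_lt_one (by positivity)]
  · exact PSpectral.lt_jointSize_of_large G hr hp rfl hG hcl hge
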